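/- Let $\mathcal X,\mathcal Z$ be finite sets; $\log$ is to base $2$. There is a constant $C$, depending only on $\mathcal X$ and $\mathcal Z$, such that for every channel $W=(W_x)_{x\in\mathcal X}$ from $\mathcal X$ to $\mathcal Z$ and every distribution $P$ on $\mathcal X$ there is a constant $G'$, depending only on $W$ and $P$, with the following property. Let $X$ have distribution $P$, let $Z$ be the output of $W$ on input $X$, let $Q=\sum_x P(x)W_x$ be its distribution, and let $H(X|Z)=H(XZ)-H(Z)$. Let $n\ge 1$, $0<\sigma\le\frac12$ and $\eta>0$ be such that for all $x\in\mathcal X$ and all distributions $R$ on $\mathcal X$ with $R(x)=0$, $$\Bigl\|W_x-\sum_y R(y)W_y\Bigr\|_1\ge\eta ,$$ and put $$\tau=\frac{\sigma^4\eta^2}{8|\mathcal X|^4|\mathcal Z|^2},\qquad \epsilon=50\,|\mathcal X||\mathcal Z|\,2^{-n\tau},\qquad \delta=2\,|\mathcal X||\mathcal Z|\,2^{-2n\tau^2}.$$ For codewords $\xi_{a\mu}\in\mathcal X^n$ ($1\le a\le K$, $1\le\mu\le L$, $L\ge1$) consider the following commitment protocol for messages $a\in\{1,\dots,K\}$. Commit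 phase: Alice picks $\mu\in\{1,\dots,L\}$ uniformly at random and sends $\xi_{a\mu}$ through $W^n$; Bob receives $z^n$; there is no other communication. Reveal phase: Alice announces $a$ and $\mu$; Bob accepts if and only if $z^n$ is conditionally $\sqrt{2\tau}$-typical given $\xi_{a\mu}$, i.e. for all $x,z$ the number $N(xz|\xi_{a\mu}z^n)$ of positions carrying the pair $(x,z)$ satisfies $|N(xz|\xi_{a\mu}z^n)-W_x(z)N(x|\xi_{a\mu})|\le\sqrt{2\tau}\,n$, and $N(xz|\xi_{a\mu}z^n)=0$ if $W_x(z)=0$. Here a protocol is $\epsilon$-concealing if, whatever Bob does in the commit phase, the distributions of all that he holds afterwards for any two messages have total variation distance at most $\epsilon$; it is $\delta$-binding if (soundness) Bob accepts with probability at least $1-\delta$ when both parties are honest, for every message, and if, whatever (possibly randomized) Alice does in the commit phase, and for all announcements $(a,\mu)$, $(a',\mu')$ depending on what she knows with $a\ne a'$ almost surely, Bob's test would accept both with probability at most $\delta$. Consider the properties 1. $d_{\rm H}(\xi_{a\mu},\xi_{a'\mu'})\ge 2\sigma n$ for all $(a,\mu)\ne(a',\mu')$; 2. $\frac12\bigl\|\frac1L\sum_{\mu=1}^L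 W^n_{\xi_{a\mu}}-Q^{\otimes n}\bigr\|_1\le 25\,|\mathcal X||\mathcal Z|\,2^{-n\tau}$ for every $a$. (a) For all codewords with properties 1 and 2, this protocol is $\epsilon$-concealing and $\delta$-binding. (b) There are $K,L\ge1$ and codewords with property 1 and (if $K\ge2$) property 2 for which the protocol is $\epsilon$-concealing and $\delta$-binding and has rate $$\frac1n\log K\ \ge\ H(X|Z)-\sqrt{2\tau}\,G'-H(2\sigma,1-2\sigma)-2\sigma\log|\mathcal X|-\frac{\log n}{n}-\frac Cn .$$ -/

import Mathlib

noncomputable section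

open scoped Classical

namespace Commitment

/-! ### Entropies (all logarithms are to base 2) -/

/-- Shannon entropy `H(p) = -∑ p(a) log₂ p(a)` of a distribution on a finite set. -/
def shannonEntropy {α : Type*} [Fintype α] (p : α → ℝ) : ℝ :=
  -∑ a, p a * Real.logb 2 (p a)

/-- The output distribution `Q(z) = ∑ₓ P(x) W(z|x)`. -/
def outputDistr {X Z : Type*} [Fintype X] (P : X → ℝ) (W : X → Z → ℝ) (z : Z) : ℝ :=
  ∑ x, P x * W x z

/-- The equivocation `H(X|Z) = H(XZ) - H(Z)`, where `X` has distribution `P` and `Z` is the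
output of the channel `W` on input `X`. -/
def equivocation {X Z : Type*} [Fintype X] [Fintype Z] (P : X → ℝ) (W : X → Z → ℝ) : ℝ :=
  shannonEntropy (fun xz : X × Z => P xz.1 * W xz.1 xz.2) - shannonEntropy (outputDistr P W)

/-! ### Channels and conditionally typical sequences -/

/-- The output distribution `W_{x₁} ⊗ ⋯ ⊗ W_{xₙ}` of `n` channel uses on the input word `x`. -/
def channelPow {X Z : Type*} {n : ℕ} (W : X → Z → ℝ) (x : Fin n → X) (z : Fin n → Z) : ℝ :=
  ∏ i, W (x i) (z i)

/-- Every `W_x` has `ℓ¹`-distance at least `η` from all mixtures of the other output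
distributions. -/
def Separated {X Z : Type*} [Fintype X] [Fintype Z] (W : X → Z → ℝ) (η : ℝ) : Prop :=
  ∀ x : X, ∀ R ∈ stdSimplex ℝ X, R x = 0 → η ≤ ∑ z, |W x z - ∑ y, R y * W y z|

/-- `N(x|xⁿ)`, the number of occurrences of the letter `x` in the word `xⁿ`. -/
def letterCount {X : Type*} {n : ℕ} (x : X) (w : Fin n → X) : ℕ :=
  (Finset.univ.filter fun i => w i = x).card

/-- `N(xz|xⁿzⁿ)`, the number of positions at which the pair of letters `(x, z)` occurs. -/
def pairCount {X Z : Type*} {n : ℕ} (x : X) (z : Z) (w : Fin n → X) (v : Fin n → Z) : ℕ :=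
  (Finset.univ.filter fun i => w i = x ∧ v i = z).card

/-- The set of conditionally `ε`-typical sequences given the word `w`.  Note that
`n · P_w(x) = N(x|w)` for the type `P_w` of `w`. -/
def condTypical {X Z : Type*} {n : ℕ} (W : X → Z → ℝ) (ε : ℝ) (w : Fin n → X) :
    Set (Fin n → Z) :=
  {v | ∀ x z, |(pairCount x z w v : ℝ) - W x z * letterCount x w| ≤ ε * n ∧
    (W x z = 0 → pairCount x z w v = 0)}

/-! ### Commitment protocols

`n` is the number of uses of the noisy channel and `r` the number of rounds of noiseless
communication in the commit phase.  The `i`-th noisy use takes place after round `time i`, where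
rounds are counted `1, …, r`; the round with index `j` below is round number `j + 1`. -/

/-- A behaviour of Alice in the commit phase, using a random variable with values in `S`:
the noiseless messages depend on `S` and on the answers of Bob in the earlier rounds, and the
`i`-th channel input depends on `S` and on the answers of Bob in the rounds `1, …, time i`. -/
structure AliceStrategy (X S U V : Type*) {n : ℕ} (time : Fin n → ℕ) where
  message : (j : ℕ) → S → (Fin j → V) → U
  input : (i : Fin n) → S → (Fin (time i) → V) → X

/-- A behaviour of Bob in the commit phase, using a random variable with values in `T`: his
answers depend on `T`, on the channel outputs received so far, and on the noiseless messages
received so far. -/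
structure BobStrategy (Z T U V : Type*) {n : ℕ} (time : Fin n → ℕ) where
  answer : (j : ℕ) → T → ({i : Fin n // time i ≤ j} → Z) → (Fin (j + 1) → U) → V

section Execution

variable {X Z S T U V : Type*} {n : ℕ} {time : Fin n → ℕ}

/-- The noiseless messages `(U^j, V^j)` of the first `j` rounds, if the random variables of Alice
and Bob have the values `s` and `t` and the channel outputs are `z`. -/
def dialogue (A : AliceStrategy X S U V time) (B : BobStrategy Z T U V time)
    (s : S) (t : T) (z : Fin n → Z) : (j : ℕ) → (Fin j → U) × (Fin j → V)
  | 0 => (Fin.elim0, Fin.elim0)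
  | j + 1 =>
    let h := dialogue A B s t z j
    let u : Fin (j + 1) → U := Fin.snoc (α := fun _ => U) h.1 (A.message j s h.2)
    (u, Fin.snoc (α := fun _ => V) h.2 (B.answer j t (fun i => z i.1) u))

/-- The probability of the channel outputs `z`, given the values `s` and `t` of the random
variables of Alice and Bob: the product of the transition probabilities along the execution. -/
def execProb (W : X → Z → ℝ) (A : AliceStrategy X S U V time) (B : BobStrategy Z T U V time)
    (s : S) (t : T) (z : Fin n → Z) : ℝ :=
  ∏ i, W (A.input i s (dialogue A B s t z (time i)).2) (z i)

/-- The probability of an event in terms of the random variable of Alice (distribution `pS`),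
the random variable of Bob (distribution `pT`, independent of it) and the channel outputs. -/
def eventProb [Fintype Z] [Fintype S] [Fintype T] (W : X → Z → ℝ)
    (pS : S → ℝ) (A : AliceStrategy X S U V time) (pT : T → ℝ) (B : BobStrategy Z T U V time)
    (E : S → T → (Fin n → Z) → Prop) : ℝ :=
  ∑ s, ∑ t, ∑ z, if E s t z then pS s * pT t * execProb W A B s t z else 0

/-- The distribution of what Bob holds after the commit phase of `r` rounds: the channel outputs,
his random variable, and the noiseless messages of Alice. -/
def viewDistr [Fintype S] (W : X → Z → ℝ)
    (pS : S → ℝ) (A : AliceStrategy X S U V time) (pT : T → ℝ) (B : BobStrategy Z T U V time)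
    (r : ℕ) (view : (Fin n → Z) × T × (Fin r → U)) : ℝ :=
  ∑ s, if (dialogue A B s view.2.1 view.1 r).1 = view.2.2
    then pS s * pT view.2.1 * execProb W A B s view.2.1 view.1 else 0

end Execution

/-- A commitment protocol with `n` noisy channel uses and `r` rounds of noiseless communication.
The set of messages is `A`; the random variables of Alice and Bob have values in `M` and `N`; the
noiseless messages of Alice and Bob are taken from `U` and `V`.  In the reveal phase Alice
announces `a : A` and `μ : M`, and Bob applies the test `accept`. -/
structure Protocol (X Z A M N U V : Type*) [Fintype M] [Fintype N] (n r : ℕ) where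
  time : Fin n → ℕ
  time_mono : Monotone time
  time_le : ∀ i, time i ≤ r
  distrM : M → ℝ
  distrM_mem : distrM ∈ stdSimplex ℝ M
  distrN : N → ℝ
  distrN_mem : distrN ∈ stdSimplex ℝ N
  alice : A → AliceStrategy X M U V time
  bob : BobStrategy Z N U V time
  accept : (Fin n → Z) → N → (Fin r → U) → A → M → Prop

namespace Protocol

variable {X Z A M N U V : Type*} [Fintype M] [Fintype N] {n r : ℕ}

/-- `ε`-concealing: for any two messages and any behaviour of Bob in the commit phase (with Alice
following the protocol), the two distributions of what Bob holds after the commit phase have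
total variation distance at most `ε`. -/
def IsConcealing [Fintype Z] [Fintype U] (p : Protocol X Z A M N U V n r) (W : X → Z → ℝ)
    (ε : ℝ) : Prop :=
  ∀ (a a' : A) (T : Type) [Fintype T] (pT : T → ℝ), pT ∈ stdSimplex ℝ T →
    ∀ B : BobStrategy Z T U V p.time,
      1 / 2 * ∑ view, |viewDistr W p.distrM (p.alice a) pT B r view -
        viewDistr W p.distrM (p.alice a') pT B r view| ≤ ε

/-- `δ`-sound: if both parties follow the protocol, then Bob accepts with probability at least
`1 - δ`. -/
def IsSound [Fintype Z] (p : Protocol X Z A M N U V n r) (W : X → Z → ℝ) (δ : ℝ) : Prop :=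
  ∀ a : A, 1 - δ ≤ eventProb W p.distrM (p.alice a) p.distrN p.bob
    (fun μ t z => p.accept z t (dialogue (p.alice a) p.bob μ t z r).1 a μ)

/-- The binding property proper: whatever Alice does in the commit phase, governed by a random
variable with values in `S`, and for all pairs of announcements `(a, μ)`, `(a', μ')` that are
functions of this random variable and of the answers of Bob, with `a ≠ a'` almost surely, the
probability that Bob would accept both of them is at most `δ`. -/
def IsCheatProof [Fintype Z] (p : Protocol X Z A M N U V n r) (W : X → Z → ℝ) (δ : ℝ) : Prop :=
  ∀ (S : Type) [Fintype S] (pS : S → ℝ), pS ∈ stdSimplex ℝ S →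
    ∀ (C : AliceStrategy X S U V p.time) (a a' : S → (Fin r → V) → A)
      (μ μ' : S → (Fin r → V) → M),
      eventProb W pS C p.distrN p.bob (fun s t z =>
        a s (dialogue C p.bob s t z r).2 = a' s (dialogue C p.bob s t z r).2) = 0 →
      eventProb W pS C p.distrN p.bob (fun s t z =>
        let h := dialogue C p.bob s t z r
        p.accept z t h.1 (a s h.2) (μ s h.2) ∧ p.accept z t h.1 (a' s h.2) (μ' s h.2)) ≤ δ

/-- `δ`-binding, short for `δ`-sound and -binding. -/
def IsBinding [Fintype Z] (p : Protocol X Z A M N U V n r) (W : X → Z → ℝ) (δ : ℝ) : Prop :=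
  p.IsSound W δ ∧ p.IsCheatProof W δ

/-- The commitment rate `(1/n) log₂ |A|`. -/
def rate [Fintype A] (_p : Protocol X Z A M N U V n r) : ℝ :=
  Real.logb 2 (Fintype.card A) / n

end Protocol

/-! ### The one-shot protocol -/

/-- The one-shot protocol for the codewords `ξ a μ`: there is no noiseless communication in the
commit phase; to commit to `a`, Alice picks `μ` uniformly at random and sends `ξ a μ` through the
channel.  To reveal, she announces `a` and `μ`, and Bob accepts if and only if his channel output
is conditionally `ε`-typical given `ξ a μ`. -/
def oneShot {X Z : Type*} (W : X → Z → ℝ) (ε : ℝ) {n K L : ℕ} (hL : 0 < L)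
    (ξ : Fin K → Fin L → Fin n → X) :
    Protocol X Z (Fin K) (Fin L) Unit Unit Unit n 0 where
  time := fun _ => 0
  time_mono := fun _ _ _ => le_rfl
  time_le := fun _ => le_rfl
  distrM := fun _ => 1 / (L : ℝ)
  distrM_mem := by
    refine ⟨fun _ => by positivity, ?_⟩
    have : (L : ℝ) ≠ 0 := by exact_mod_cast hL.ne'
    simp [this]
  distrN := fun _ => 1
  distrN_mem := by
    refine ⟨fun _ => zero_le_one, ?_⟩
    simp
  alice := fun a => ⟨fun _ _ _ => (), fun i μ _ => ξ a μ i⟩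
  bob := ⟨fun _ _ _ _ => ()⟩
  accept := fun z _ _ a μ => z ∈ condTypical W ε (ξ a μ)

/-- Distinct codewords have Hamming distance at least `2σn`. -/
def CodeSpread {X : Type*} {n K L : ℕ} (σ : ℝ) (ξ : Fin K → Fin L → Fin n → X) : Prop :=
  ∀ a μ a' μ', (a, μ) ≠ (a', μ') → 2 * σ * n ≤ hammingDist (ξ a μ) (ξ a' μ')

/-- For every `a`, the average output distribution over the codewords `ξ a μ` has total variation
distance at most `θ` from the `n`-fold product of the output distribution of `P`. -/
def CodeBlurred {X Z : Type*} [Fintype X] [Fintype Z] {n K L : ℕ} (W : X → Z → ℝ) (P : X → ℝ)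
    (θ : ℝ) (ξ : Fin K → Fin L → Fin n → X) : Prop :=
  ∀ a, 1 / 2 * ∑ z : Fin n → Z,
    |1 / (L : ℝ) * ∑ μ, channelPow W (ξ a μ) z - ∏ i, outputDistr P W (z i)| ≤ θ

end Commitment

end

open Commitment

noncomputable section

open scoped Classical

namespace Commitment

/-! ### Hoeffding's inequality for product weights on words -/

/-! Concealing: the commit phase has no noiseless communication, so Bob holds only `z` and his own
independent randomness. Property 2 puts the law of `z` for every message near the same product
distribution, and the triangle inequality compares two messages (`oneShot_isConcealing`).

Soundness is Hoeffding's inequality for every pair count and a union bound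
(`sum_not_condTypical_le`). For the binding property, whatever word `w` Alice sends, two codewords
at distance `2σn` cannot both be within less than `σn` of it. Let `u` be one that is at distance at
least `σn`. Some letter `x` of `u` is then replaced in at least `σn/|X|` positions. The average
output law there is a mixture of the `W_y` with `y ≠ x`, so separation moves the expectation of some
count of `(x, z)` by at least `σηn/(|X||Z|)`, which is at least `2√(2τ) n`. Typicality given `u`
would need a deviation of at least `√(2τ) n` from that expectation, and Hoeffding applies again
(`sum_condTypical_le_of_far`).

Existence of codes: codewords are chosen greedily, in `K` blocks of `L` words
(`exists_covering_blocks`). Truncated output laws are viewed as vectors in `L²(1/Q)`, centred at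
`Q`. Their mean over the typical inputs is nearly zero even after the Hamming balls around earlier
codewords are removed, so some admissible word barely lengthens the running sum of its block. With
`L` about `2^{nI}` the block average is close to `Q`. The balls may be removed as long as `K L ·
|ball| · 2^{-nH(X)}` is small, which leaves `log K` about `n(H(X) - I) - log |ball|`, where `H(X) -
I = H(X|Z)`; `card_hammingBall_le` bounds the ball. -/

/-- Hoeffding's lemma for a distribution on a finite set. -/
theorem sum_mul_exp_le {α : Type*} [Fintype α] {p : α → ℝ} (hp : p ∈ stdSimplex ℝ α)
    {f : α → ℝ} {a b : ℝ} (hf : ∀ x, f x ∈ Set.Icc a b) (s : ℝ) :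
    ∑ x, p x * Real.exp (s * (f x - ∑ y, p y * f y)) ≤ Real.exp (s ^ 2 * (b - a) ^ 2 / 8) := by
  let _ : MeasurableSpace α := ⊤
  have hsum : ∑ x, ENNReal.ofReal (p x) = 1 := by
    rw [← ENNReal.ofReal_sum_of_nonneg fun i _ => hp.1 i, hp.2, ENNReal.ofReal_one]
  let q : PMF α := PMF.ofFintype (fun x => ENNReal.ofReal (p x)) hsum
  have hq : ∀ g : α → ℝ, ∫ x, g x ∂q.toMeasure = ∑ x, p x * g x := by
    intro g
    rw [PMF.integral_eq_sum]
    refine Finset.sum_congr rfl fun x _ => ?_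
    simp [q, ENNReal.toReal_ofReal (hp.1 x)]
  -- A variable with values in `[a, b]` is, after centring, sub-Gaussian with variance proxy `((b -
  -- a) / 2)²`.
  have h := (ProbabilityTheory.hasSubgaussianMGF_of_mem_Icc (μ := q.toMeasure) (X := f)
    (measurable_of_finite f).aemeasurable (Filter.Eventually.of_forall hf)).mgf_le s
  rw [ProbabilityTheory.mgf, hq, hq] at h
  refine h.trans_eq ?_
  congr 1
  simp only [NNReal.coe_pow, NNReal.coe_div, coe_nnnorm, Real.norm_eq_abs, NNReal.coe_ofNat,
    div_pow, sq_abs]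
  ring

theorem sum_prod_eq_one {α : Type*} [Fintype α] {n : ℕ} {p : Fin n → α → ℝ}
    (hp : ∀ i, p i ∈ stdSimplex ℝ α) : ∑ z : Fin n → α, ∏ i, p i (z i) = 1 := by
  have h := Finset.prod_univ_sum (fun _ : Fin n => (Finset.univ : Finset α)) p
  rw [Fintype.piFinset_univ] at h
  rw [← h]
  exact Finset.prod_eq_one fun i _ => (hp i).2

theorem prod_mem_stdSimplex {α : Type*} [Fintype α] {n : ℕ} {p : Fin n → α → ℝ}
    (hp : ∀ i, p i ∈ stdSimplex ℝ α) :
    (fun z : Fin n → α => ∏ i, p i (z i)) ∈ stdSimplex ℝ (Fin n → α) :=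
  ⟨fun z => Finset.prod_nonneg fun i _ => (hp i).1 (z i), sum_prod_eq_one hp⟩

/-- Upper tail of Hoeffding's inequality for independent letters. -/
theorem hoeffding_upper {α : Type*} [Fintype α] {n : ℕ} (hn : 0 < n) {p : Fin n → α → ℝ}
    (hp : ∀ i, p i ∈ stdSimplex ℝ α) {f : Fin n → α → ℝ} {a b : ℝ} (hab : a < b)
    (hf : ∀ i x, f i x ∈ Set.Icc a b) {t : ℝ} (ht : 0 ≤ t) :
    ∑ z : Fin n → α, (if ∑ i, ∑ x, p i x * f i x + n * t ≤ ∑ i, f i (z i)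
      then ∏ i, p i (z i) else 0) ≤ Real.exp (-(2 * n * t ^ 2 / (b - a) ^ 2)) := by
  set m : Fin n → ℝ := fun i => ∑ x, p i x * f i x with hm
  -- This `s` minimises the Chernoff exponent `-s t + s² (b - a)² / 8`.
  set s : ℝ := 4 * t / (b - a) ^ 2 with hs
  have hba : 0 < (b - a) ^ 2 := by have := sub_pos.2 hab; positivity
  have hs0 : 0 ≤ s := by positivity
  have hw : ∀ z : Fin n → α, 0 ≤ ∏ i, p i (z i) := (prod_mem_stdSimplex hp).1
  calc _ ≤ ∑ z : Fin n → α, Real.exp (-(s * (n * t))) *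
        ∏ i, (p i (z i) * Real.exp (s * (f i (z i) - m i))) := by
        refine Finset.sum_le_sum fun z _ => ?_
        rw [Finset.prod_mul_distrib, ← Real.exp_sum, mul_left_comm, ← Real.exp_add]
        split_ifs with h
        · refine le_mul_of_one_le_right (hw z) (Real.one_le_exp ?_)
          rw [← Finset.mul_sum, Finset.sum_sub_distrib]
          have := mul_le_mul_of_nonneg_left h hs0
          linarith
        · exact mul_nonneg (hw z) (Real.exp_pos _).le
    _ = Real.exp (-(s * (n * t))) * ∏ i, ∑ x, p i x * Real.exp (s * (f i x - m i)) := by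
        have h := Finset.prod_univ_sum (fun _ : Fin n => (Finset.univ : Finset α))
          (fun i x => p i x * Real.exp (s * (f i x - m i)))
        rw [Fintype.piFinset_univ] at h
        rw [h, Finset.mul_sum]
    _ ≤ Real.exp (-(s * (n * t))) * ∏ _i : Fin n, Real.exp (s ^ 2 * (b - a) ^ 2 / 8) := by
        refine mul_le_mul_of_nonneg_left (Finset.prod_le_prod (fun i _ => ?_) fun i _ => ?_)
          (Real.exp_pos _).le
        · exact Finset.sum_nonneg fun x _ => mul_nonneg ((hp i).1 x) (Real.exp_pos _).le
        · exact sum_mul_exp_le (hp i) (hf i) s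
    _ = Real.exp (-(2 * n * t ^ 2 / (b - a) ^ 2)) := by
        rw [Finset.prod_const, Finset.card_univ, Fintype.card_fin, ← Real.exp_nat_mul,
          ← Real.exp_add]
        congr 1
        rw [hs]
        field_simp
        ring

/-- The lower tail is the upper tail of `1 - f`. -/
theorem hoeffding_abs {α : Type*} [Fintype α] {n : ℕ} (hn : 0 < n) {p : Fin n → α → ℝ}
    (hp : ∀ i, p i ∈ stdSimplex ℝ α) {f : Fin n → α → ℝ}
    (hf : ∀ i x, f i x ∈ Set.Icc (0 : ℝ) 1) {t : ℝ} (ht : 0 ≤ t) :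
    ∑ z : Fin n → α, (if n * t ≤ |∑ i, f i (z i) - ∑ i, ∑ x, p i x * f i x|
      then ∏ i, p i (z i) else 0) ≤ 2 * Real.exp (-(2 * n * t ^ 2)) := by
  have h1 := hoeffding_upper hn hp zero_lt_one hf ht
  have h2 := hoeffding_upper (f := fun i x => 1 - f i x) hn hp zero_lt_one
    (fun i x => ⟨by linarith [(hf i x).2], by linarith [(hf i x).1]⟩) ht
  simp only [sub_zero, one_pow, div_one] at h1 h2
  have hm : ∑ i, ∑ x, p i x * (1 - f i x) = n - ∑ i, ∑ x, p i x * f i x := by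
    simp only [mul_sub, mul_one, Finset.sum_sub_distrib]
    congr 1
    rw [Finset.sum_congr rfl fun i _ => (hp i).2]
    simp
  rw [two_mul]
  refine le_trans ?_ (add_le_add h1 h2)
  rw [← Finset.sum_add_distrib]
  refine Finset.sum_le_sum fun z _ => ?_
  have hw : 0 ≤ ∏ i, p i (z i) := (prod_mem_stdSimplex hp).1 z
  have hz : ∑ i, (1 - f i (z i)) = n - ∑ i, f i (z i) := by
    simp [Finset.sum_sub_distrib]
  rw [hm, hz]
  by_cases h : n * t ≤ |∑ i, f i (z i) - ∑ i, ∑ x, p i x * f i x|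
  · rw [if_pos h]
    rcases le_abs.1 h with h' | h'
    · rw [if_pos (by linarith)]
      split_ifs <;> linarith
    · rw [if_pos (c := _ + _ ≤ (n : ℝ) - _) (by linarith)]
      split_ifs <;> linarith
  · rw [if_neg h]
    split_ifs <;> linarith

/-! ### Conditionally typical sequences -/

section Typical

variable {X Z : Type*} {n : ℕ} {W : X → Z → ℝ}

theorem pairCount_eq_sum (x : X) (z : Z) (w : Fin n → X) (v : Fin n → Z) :
    (pairCount x z w v : ℝ) = ∑ i, if w i = x ∧ v i = z then 1 else 0 := by
  simp [pairCount]

theorem letterCount_eq_sum (x : X) (w : Fin n → X) :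
    (letterCount x w : ℝ) = ∑ i, if w i = x then 1 else 0 := by
  simp [letterCount]

/-- The clause about vanishing transition probabilities is automatic for outputs of positive
probability. -/
theorem mem_condTypical_of_forall {ε : ℝ} {w : Fin n → X}
    {v : Fin n → Z} (hv : channelPow W w v ≠ 0)
    (h : ∀ x z, |(pairCount x z w v : ℝ) - W x z * letterCount x w| ≤ ε * n) :
    v ∈ condTypical W ε w := by
  refine fun x z => ⟨h x z, fun h0 => ?_⟩
  rw [pairCount, Finset.card_eq_zero, Finset.filter_eq_empty_iff]
  rintro i - ⟨rfl, rfl⟩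
  exact hv (Finset.prod_eq_zero (Finset.mem_univ i) h0)

variable [Fintype Z]

theorem channelPow_mem_stdSimplex (hW : ∀ x, W x ∈ stdSimplex ℝ Z) (w : Fin n → X) :
    channelPow W w ∈ stdSimplex ℝ (Fin n → Z) :=
  prod_mem_stdSimplex fun i => hW (w i)

/-- The expected number of pairs `(x, z)` between a fixed word and the channel output on input
`w` is a sum of transition probabilities. -/
theorem sum_sum_mul_indicator (W : X → Z → ℝ) (x : X) (z : Z) (u w : Fin n → X) :
    ∑ i, ∑ y, W (w i) y * (if u i = x ∧ y = z then 1 else 0) =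
      ∑ i, if u i = x then W (w i) z else 0 := by
  refine Finset.sum_congr rfl fun i _ => ?_
  by_cases h : u i = x <;> simp [h]

/-- Pairs are counted against `u` while the channel input is `w`: the case `u = w` serves soundness,
the case of distant words serves the binding property. -/
theorem hoeffding_pairCount (hn : 0 < n) (hW : ∀ x, W x ∈ stdSimplex ℝ Z) (x : X) (z : Z)
    (u w : Fin n → X) {t : ℝ} (ht : 0 ≤ t) :
    ∑ v : Fin n → Z, (if n * t ≤ |(pairCount x z u v : ℝ) - ∑ i, if u i = x then W (w i) z else 0|
      then channelPow W w v else 0) ≤ 2 * Real.exp (-(2 * n * t ^ 2)) := by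
  have h := hoeffding_abs hn (fun i => hW (w i))
    (f := fun i y => if u i = x ∧ y = z then 1 else 0)
    (fun i y => by split_ifs <;> simp) ht
  simpa only [sum_sum_mul_indicator, ← pairCount_eq_sum, channelPow] using h

theorem abs_pairCount_sub_le (hW : ∀ x, W x ∈ stdSimplex ℝ Z) (x : X) (z : Z) (w : Fin n → X)
    (v : Fin n → Z) : |(pairCount x z w v : ℝ) - W x z * letterCount x w| ≤ n := by
  have h1 : (pairCount x z w v : ℝ) ≤ n := by
    exact_mod_cast (Finset.card_le_univ _).trans_eq (Fintype.card_fin n)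
  have h2 : (letterCount x w : ℝ) ≤ n := by
    exact_mod_cast (Finset.card_le_univ _).trans_eq (Fintype.card_fin n)
  have h3 : W x z ≤ 1 := by
    rw [← (hW x).2]
    exact Finset.single_le_sum (fun y _ => (hW x).1 y) (Finset.mem_univ z)
  have h4 := (hW x).1 z
  have h5 : (0 : ℝ) ≤ letterCount x w := Nat.cast_nonneg _
  have h6 : (0 : ℝ) ≤ pairCount x z w v := Nat.cast_nonneg _
  rw [abs_le]
  constructor <;> nlinarith

variable [Fintype X]

/-- The channel output is conditionally typical given the input, up to a small probability. -/
theorem sum_not_condTypical_le (hn : 0 < n) (hW : ∀ x, W x ∈ stdSimplex ℝ Z) (w : Fin n → X)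
    {ε : ℝ} (hε : 0 ≤ ε) :
    ∑ v : Fin n → Z, (if v ∈ condTypical W ε w then 0 else channelPow W w v) ≤
      2 * Fintype.card X * Fintype.card Z * Real.exp (-(2 * n * ε ^ 2)) := by
  have hw := (channelPow_mem_stdSimplex hW w).1
  calc _ ≤ ∑ v : Fin n → Z, ∑ x, ∑ z,
        (if n * ε ≤ |(pairCount x z w v : ℝ) - ∑ i, if w i = x then W (w i) z else 0|
          then channelPow W w v else 0) := by
        refine Finset.sum_le_sum fun v _ => ?_
        have hnn : ∀ x z, 0 ≤ (if n * ε ≤ |(pairCount x z w v : ℝ) -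
            ∑ i, if w i = x then W (w i) z else 0| then channelPow W w v else 0) := by
          intro x z; split_ifs; exacts [hw v, le_rfl]
        split_ifs with hv
        · exact Finset.sum_nonneg fun x _ => Finset.sum_nonneg fun z _ => hnn x z
        · by_cases h0 : channelPow W w v = 0
          · simp [h0]
          · have : ∃ x z, ε * n < |(pairCount x z w v : ℝ) - W x z * letterCount x w| := by
              by_contra! h
              exact hv (mem_condTypical_of_forall h0 h)
            obtain ⟨x, z, hxz⟩ := this
            have he : W x z * letterCount x w = ∑ i, if w i = x then W (w i) z else 0 := by
              rw [letterCount_eq_sum, Finset.mul_sum]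
              refine Finset.sum_congr rfl fun i _ => ?_
              split_ifs with h <;> simp [h]
            rw [he] at hxz
            refine le_trans ?_ (Finset.single_le_sum
              (fun x _ => Finset.sum_nonneg fun z _ => hnn x z) (Finset.mem_univ x))
            refine le_trans ?_ (Finset.single_le_sum (fun z _ => hnn x z) (Finset.mem_univ z))
            rw [if_pos (by linarith)]
    _ = ∑ x, ∑ z, ∑ v : Fin n → Z,
        (if n * ε ≤ |(pairCount x z w v : ℝ) - ∑ i, if w i = x then W (w i) z else 0|
          then channelPow W w v else 0) := by
        rw [Finset.sum_comm]
        exact Finset.sum_congr rfl fun x _ => Finset.sum_comm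
    _ ≤ ∑ _x : X, ∑ _z : Z, 2 * Real.exp (-(2 * n * ε ^ 2)) :=
        Finset.sum_le_sum fun x _ => Finset.sum_le_sum fun z _ =>
          hoeffding_pairCount hn hW x z w w hε
    _ = _ := by simp; ring

/-- If `w` and `u` are at Hamming distance at least `σ n`, then some letter `x` of `u` is
replaced in at least `σ n / |X|` positions. -/
theorem exists_letter_of_le_hammingDist [Nonempty X] {u w : Fin n → X} {d : ℝ}
    (h : d ≤ hammingDist w u) :
    ∃ x, d / Fintype.card X ≤ (Finset.univ.filter fun i => u i = x ∧ w i ≠ x).card := by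
  by_contra! hc
  have hd : (hammingDist w u : ℝ) =
      ∑ x, ((Finset.univ.filter fun i => u i = x ∧ w i ≠ x).card : ℝ) := by
    rw [hammingDist, Finset.card_eq_sum_card_fiberwise (f := u) (t := Finset.univ)
      (fun _ _ => Finset.mem_coe.2 (Finset.mem_univ _))]
    push_cast
    refine Finset.sum_congr rfl fun x _ => ?_
    congr 2
    ext i
    simp only [Finset.mem_filter, Finset.mem_univ, true_and]
    constructor
    · rintro ⟨h1, rfl⟩; exact ⟨rfl, h1⟩
    · rintro ⟨rfl, h1⟩; exact ⟨h1, rfl⟩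
  have hX : (0 : ℝ) < Fintype.card X := by exact_mod_cast Fintype.card_pos
  have : (hammingDist w u : ℝ) < ∑ _x : X, d / Fintype.card X := by
    rw [hd]
    exact Finset.sum_lt_sum_of_nonempty Finset.univ_nonempty fun x _ => hc x
  rw [Finset.sum_const, Finset.card_univ, nsmul_eq_mul, mul_div_cancel₀ _ hX.ne'] at this
  linarith

/-- The separation of the channel forces the expected number of some pair away from its typical
value when enough occurrences of a letter are replaced. -/
theorem exists_pair_of_separated [Nonempty Z] {η : ℝ} (hsep : Separated W η) {u w : Fin n → X}
    {x : X} {M : ℕ} (hM : (Finset.univ.filter fun i => u i = x ∧ w i ≠ x).card = M) (hM0 : 0 < M) :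
    ∃ z, M * (η / Fintype.card Z) ≤
      |(∑ i, if u i = x then W (w i) z else 0) - W x z * letterCount x u| := by
  set S := Finset.univ.filter fun i => u i = x ∧ w i ≠ x
  have hMr : (0 : ℝ) < M := by exact_mod_cast hM0
  -- `R` is the empirical distribution of the letters that `w` puts in place of `x`; it gives no
  -- mass to `x`.
  let R : X → ℝ := fun y => (1 / (M : ℝ)) * ∑ i ∈ S, if w i = y then 1 else 0
  have hR : R ∈ stdSimplex ℝ X := by
    refine ⟨fun y => mul_nonneg (by positivity)
      (Finset.sum_nonneg fun i _ => by split_ifs <;> simp), ?_⟩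
    simp only [R]
    rw [← Finset.mul_sum, Finset.sum_comm]
    simp [hM, hMr.ne']
  have hRx : R x = 0 := by
    simp only [R]
    rw [Finset.sum_eq_zero fun i hi => if_neg (Finset.mem_filter.1 hi).2.2, mul_zero]
  have hRW : ∀ z, ∑ y, R y * W y z = (1 / (M : ℝ)) * ∑ i ∈ S, W (w i) z := by
    intro z
    simp only [R, mul_assoc]
    rw [← Finset.mul_sum]
    congr 1
    simp only [Finset.sum_mul]
    rw [Finset.sum_comm]
    simp
  -- Positions where both words carry `x` contribute `W x z` to both terms and cancel; only the
  -- replaced ones remain.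
  have key : ∀ z, (∑ i, if u i = x then W (w i) z else 0) - W x z * letterCount x u =
      -(M * (W x z - ∑ y, R y * W y z)) := by
    intro z
    rw [hRW, mul_sub, ← mul_assoc, mul_one_div_cancel hMr.ne', one_mul, letterCount_eq_sum,
      Finset.mul_sum, ← Finset.sum_sub_distrib, neg_sub, ← hM, Finset.cast_card,
      Finset.sum_mul, ← Finset.sum_sub_distrib, Finset.sum_filter]
    refine Finset.sum_congr rfl fun i _ => ?_
    by_cases h1 : u i = x <;> by_cases h2 : w i = x <;> simp [h1, h2]
  by_contra! hc
  have hZ : (0 : ℝ) < Fintype.card Z := by exact_mod_cast Fintype.card_pos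
  have h1 : ∑ z, M * |W x z - ∑ y, R y * W y z| < ∑ _z : Z, M * (η / Fintype.card Z) := by
    refine Finset.sum_lt_sum_of_nonempty Finset.univ_nonempty fun z _ => ?_
    have := hc z
    rwa [key, abs_neg, abs_mul, abs_of_pos hMr] at this
  rw [← Finset.mul_sum, Finset.sum_const, Finset.card_univ, nsmul_eq_mul, mul_left_comm,
    mul_div_cancel₀ _ hZ.ne'] at h1
  exact absurd (hsep x R hR hRx) (not_le.2 (lt_of_mul_lt_mul_left h1 hMr.le))

/-- The channel output on an input word far away from `u` is unlikely to be conditionally typical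
given `u`. -/
theorem sum_condTypical_le_of_far [Nonempty X] [Nonempty Z] (hn : 0 < n)
    (hW : ∀ x, W x ∈ stdSimplex ℝ Z) {σ η ε t : ℝ} (hσ : 0 < σ) (hη : 0 < η)
    (hsep : Separated W η) {u w : Fin n → X} (hd : σ * n ≤ hammingDist w u) (ht : 0 ≤ t)
    (htε : t + ε ≤ σ * η / (Fintype.card X * Fintype.card Z)) :
    ∑ v : Fin n → Z, (if v ∈ condTypical W ε u then channelPow W w v else 0) ≤
      2 * Real.exp (-(2 * n * t ^ 2)) := by
  have hw := (channelPow_mem_stdSimplex hW w).1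
  obtain ⟨x, hx⟩ := exists_letter_of_le_hammingDist hd
  have hX : (0 : ℝ) < Fintype.card X := by exact_mod_cast Fintype.card_pos
  have hZ : (0 : ℝ) < Fintype.card Z := by exact_mod_cast Fintype.card_pos
  have hnr : (0 : ℝ) < n := by exact_mod_cast hn
  have hpos : 0 < σ * n / Fintype.card X := by positivity
  obtain ⟨z, hz⟩ := exists_pair_of_separated hsep (u := u) (w := w) (x := x) rfl
    (by exact_mod_cast hpos.trans_le hx)
  refine le_trans (Finset.sum_le_sum fun v _ => ?_) (hoeffding_pairCount hn hW x z u w ht)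
  split_ifs with h1 h2 h2
  · exact le_rfl
  -- Typicality puts the count within `ε n` of `W x z * letterCount x u`, which lies at least `(t +
  -- ε) n` from the true expectation; so the count deviates by at least `t n`.
  · exfalso
    apply h2
    have h3 := (h1 x z).1
    have h4 : (σ * n / Fintype.card X) * (η / Fintype.card Z) ≤ _ :=
      (mul_le_mul_of_nonneg_right hx (by positivity)).trans hz
    have h5 : (σ * n / Fintype.card X) * (η / Fintype.card Z) =
      σ * η / (Fintype.card X * Fintype.card Z) * n := by field_simp
    have h6 := mul_le_mul_of_nonneg_right htε hnr.le
    have h7 := abs_sub_le (∑ i, if u i = x then W (w i) z else 0) (pairCount x z u v : ℝ)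
      (W x z * letterCount x u)
    rw [abs_sub_comm _ (pairCount x z u v : ℝ)] at h7
    linarith
  · exact hw v
  · exact le_rfl

end Typical

theorem exp_neg_le_two_rpow_neg {a b : ℝ} (hb : 0 ≤ b) (h : b ≤ a) :
    Real.exp (-a) ≤ (2 : ℝ) ^ (-b) := by
  rw [Real.rpow_def_of_pos two_pos, Real.exp_le_exp]
  have h2 : Real.log 2 ≤ 1 := by linarith [Real.log_two_lt_d9]
  nlinarith

/-! ### Security of the one-shot protocol -/

section Security

variable {X Z : Type*} {n K L : ℕ} {W : X → Z → ℝ}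

theorem sum_abs_sub_le_add {α : Type*} [Fintype α] (f g h : α → ℝ) :
    ∑ x, |f x - g x| ≤ ∑ x, |f x - h x| + ∑ x, |g x - h x| := by
  rw [← Finset.sum_add_distrib]
  refine Finset.sum_le_sum fun x _ => ?_
  rw [abs_sub_comm (g x)]
  exact abs_sub_le _ _ _

theorem oneShot_viewDistr {ε : ℝ} (hL : 0 < L) (ξ : Fin K → Fin L → Fin n → X) (a : Fin K)
    {T : Type*} (pT : T → ℝ) (B : BobStrategy Z T Unit Unit (oneShot W ε hL ξ).time)
    (z : Fin n → Z) (t : T) (u : Fin 0 → Unit) :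
    viewDistr W (oneShot W ε hL ξ).distrM ((oneShot W ε hL ξ).alice a) pT B 0 (z, t, u) =
      pT t * (1 / (L : ℝ) * ∑ μ, channelPow W (ξ a μ) z) := by
  rw [viewDistr, Finset.mul_sum, Finset.mul_sum]
  refine Finset.sum_congr rfl fun μ _ => ?_
  rw [if_pos (Subsingleton.elim _ _)]
  change 1 / (L : ℝ) * pT t * channelPow W (ξ a μ) z = _
  ring

variable [Fintype Z]

/-- Since nothing is exchanged, the weight `pT` of Bob's randomness factors out of his view and sums
to one. What remains is a distance of two block averages, each within `ε / 2` of the same product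
distribution. -/
theorem oneShot_isConcealing [Fintype X] {P : X → ℝ} {ε ε' : ℝ} (hL : 0 < L)
    {ξ : Fin K → Fin L → Fin n → X} (hξ : CodeBlurred W P (ε / 2) ξ) :
    (oneShot W ε' hL ξ).IsConcealing W ε := by
  intro a a' T _ pT hpT B
  have h : ∀ view : (Fin n → Z) × T × (Fin 0 → Unit),
      |viewDistr W (oneShot W ε' hL ξ).distrM ((oneShot W ε' hL ξ).alice a) pT B 0 view -
        viewDistr W (oneShot W ε' hL ξ).distrM ((oneShot W ε' hL ξ).alice a') pT B 0 view| =
      pT view.2.1 * |1 / (L : ℝ) * ∑ μ, channelPow W (ξ a μ) view.1 -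
        1 / (L : ℝ) * ∑ μ, channelPow W (ξ a' μ) view.1| := by
    rintro ⟨z, t, u⟩
    rw [oneShot_viewDistr, oneShot_viewDistr, ← mul_sub, abs_mul, abs_of_nonneg (hpT.1 t)]
  rw [Finset.sum_congr rfl fun view _ => h view, Fintype.sum_prod_type]
  simp only [Fintype.sum_prod_type, Fintype.sum_unique]
  rw [Finset.sum_congr rfl fun z _ => (Finset.sum_mul Finset.univ pT _).symm]
  rw [hpT.2]
  simp only [one_mul]
  have h1 := sum_abs_sub_le_add (fun z => 1 / (L : ℝ) * ∑ μ, channelPow W (ξ a μ) z)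
    (fun z => 1 / (L : ℝ) * ∑ μ, channelPow W (ξ a' μ) z)
    (fun z => ∏ i, outputDistr P W (z i))
  have h2 := hξ a
  have h3 := hξ a'
  linarith

theorem oneShot_isSound {ε δ : ℝ} (hL : 0 < L) (ξ : Fin K → Fin L → Fin n → X)
    (hW : ∀ x, W x ∈ stdSimplex ℝ Z)
    (h : ∀ w : Fin n → X,
      ∑ v : Fin n → Z, (if v ∈ condTypical W ε w then 0 else channelPow W w v) ≤ δ) :
    (oneShot W ε hL ξ).IsSound W δ := by
  intro a
  have h1 : eventProb W (oneShot W ε hL ξ).distrM ((oneShot W ε hL ξ).alice a)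
      (oneShot W ε hL ξ).distrN (oneShot W ε hL ξ).bob
      (fun μ t z => (oneShot W ε hL ξ).accept z t
        (dialogue ((oneShot W ε hL ξ).alice a) (oneShot W ε hL ξ).bob μ t z 0).1 a μ) =
      ∑ μ, 1 / (L : ℝ) * ∑ v : Fin n → Z,
        (if v ∈ condTypical W ε (ξ a μ) then channelPow W (ξ a μ) v else 0) := by
    refine Finset.sum_congr rfl fun μ _ => ?_
    rw [Fintype.sum_unique, Finset.mul_sum]
    refine Finset.sum_congr rfl fun v _ => ?_
    change (if v ∈ condTypical W ε (ξ a μ) then 1 / (L : ℝ) * 1 * channelPow W (ξ a μ) v else 0) = _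
    split_ifs <;> simp
  rw [h1]
  have h2 : ∀ μ, 1 - δ ≤ ∑ v : Fin n → Z,
      (if v ∈ condTypical W ε (ξ a μ) then channelPow W (ξ a μ) v else 0) := by
    intro μ
    have h3 := h (ξ a μ)
    have h4 := (channelPow_mem_stdSimplex hW (ξ a μ)).2
    have h5 : ∑ v : Fin n → Z,
        ((if v ∈ condTypical W ε (ξ a μ) then channelPow W (ξ a μ) v else 0) +
        (if v ∈ condTypical W ε (ξ a μ) then 0 else channelPow W (ξ a μ) v)) = 1 := by
      rw [← h4]
      refine Finset.sum_congr rfl fun v _ => ?_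
      split_ifs <;> simp
    rw [Finset.sum_add_distrib] at h5
    linarith
  have hL' : (0 : ℝ) < L := by exact_mod_cast hL
  calc 1 - δ = ∑ _μ : Fin L, 1 / (L : ℝ) * (1 - δ) := by
        rw [Finset.sum_const, Finset.card_univ, Fintype.card_fin, nsmul_eq_mul]
        field_simp
    _ ≤ _ := Finset.sum_le_sum fun μ _ => mul_le_mul_of_nonneg_left (h2 μ) (by positivity)

/-- Conditioned on Alice's randomness `s`, the input word and both announcements are fixed. By the
triangle inequality one of the two announced codewords is at distance at least `σ n` from the input,
and acceptance of that one alone is already unlikely. -/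
theorem oneShot_isCheatProof {σ ε δ : ℝ} (hL : 0 < L) {ξ : Fin K → Fin L → Fin n → X}
    (hW : ∀ x, W x ∈ stdSimplex ℝ Z) (hξ : CodeSpread σ ξ)
    (h : ∀ u w : Fin n → X, σ * n ≤ hammingDist w u →
      ∑ v : Fin n → Z, (if v ∈ condTypical W ε u then channelPow W w v else 0) ≤ δ) :
    (oneShot W ε hL ξ).IsCheatProof W δ := by
  intro S _ pS hpS C a a' μ μ' hne
  let e : Fin 0 → Unit := Fin.elim0
  let w : S → Fin n → X := fun s i => C.input i s Fin.elim0
  have h1 : ∀ E : S → Unit → (Fin n → Z) → Prop,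
      eventProb W pS C (oneShot W ε hL ξ).distrN (oneShot W ε hL ξ).bob E =
      ∑ s, pS s * ∑ v : Fin n → Z, (if E s () v then channelPow W (w s) v else 0) := by
    intro E
    refine Finset.sum_congr rfl fun s _ => ?_
    rw [Fintype.sum_unique, Finset.mul_sum]
    refine Finset.sum_congr rfl fun v _ => ?_
    change (if E s () v then pS s * 1 * channelPow W (w s) v else 0) = _
    split_ifs <;> simp
  have hnn : ∀ (s : S) (v : Fin n → Z), 0 ≤ channelPow W (w s) v := fun s =>
    (channelPow_mem_stdSimplex hW (w s)).1
  rw [h1] at hne ⊢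
  -- For fixed `s` equality of the announcements does not depend on the channel output, so it would
  -- contribute the full weight `pS s` to an event of probability zero.
  have hne' : ∀ s, pS s ≠ 0 → a s e ≠ a' s e := by
    intro s hs heq
    rw [Finset.sum_eq_zero_iff_of_nonneg fun s _ => mul_nonneg (hpS.1 s)
      (Finset.sum_nonneg fun v _ => by split_ifs; exacts [hnn s v, le_rfl])] at hne
    have h2 := hne s (Finset.mem_univ s)
    have h3 : ∀ v, (dialogue C (oneShot W ε hL ξ).bob s () v 0).2 = e := fun _ => rfl
    simp only [h3, heq, if_true, (channelPow_mem_stdSimplex hW (w s)).2, mul_one] at h2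
    exact hs h2
  calc _ ≤ ∑ s, pS s * δ := by
        refine Finset.sum_le_sum fun s _ => ?_
        by_cases hs : pS s = 0
        · simp [hs]
        refine mul_le_mul_of_nonneg_left ?_ (hpS.1 s)
        have hd := hξ (a s e) (μ s e) (a' s e) (μ' s e) fun h => hne' s hs (congrArg Prod.fst h)
        have htri := hammingDist_triangle_left (ξ (a s e) (μ s e)) (ξ (a' s e) (μ' s e)) (w s)
        have htri' : (hammingDist (ξ (a s e) (μ s e)) (ξ (a' s e) (μ' s e)) : ℝ) ≤
            hammingDist (w s) (ξ (a s e) (μ s e)) + hammingDist (w s) (ξ (a' s e) (μ' s e)) := by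
          exact_mod_cast htri
        rcases le_or_gt (σ * n) (hammingDist (w s) (ξ (a s e) (μ s e)) : ℝ) with h2 | h2
        · refine le_trans (Finset.sum_le_sum fun v _ => ?_) (h _ _ h2)
          split_ifs with h3 h4 h4
          exacts [le_rfl, absurd (And.left h3) h4, hnn s v, le_rfl]
        · refine le_trans (Finset.sum_le_sum fun v _ => ?_) (h (ξ (a' s e) (μ' s e)) (w s)
            (by linarith))
          split_ifs with h3 h4 h4
          exacts [le_rfl, absurd (And.right h3) h4, hnn s v, le_rfl]
    _ = δ := by rw [← Finset.sum_mul, hpS.2, one_mul]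

end Security

/-! ### The parameters of the proposition -/

section Parameters

variable {X Z : Type*} [Fintype X] [Fintype Z] {n : ℕ} {W : X → Z → ℝ} {σ η τ : ℝ}

theorem le_two_of_separated [Nontrivial X] (hW : ∀ x, W x ∈ stdSimplex ℝ Z)
    (hsep : Separated W η) : η ≤ 2 := by
  obtain ⟨x, y, hxy⟩ := exists_pair_ne X
  have h := hsep x (Pi.single y 1) (single_mem_stdSimplex ℝ y) (by simp [hxy])
  refine h.trans ?_
  calc _ ≤ ∑ z, (W x z + W y z) := by
        refine Finset.sum_le_sum fun z _ => ?_
        have : ∑ y', (Pi.single y 1 : X → ℝ) y' * W y' z = W y z := by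
          simp [Pi.single_apply]
        rw [this]
        have h1 := (hW x).1 z
        have h2 := (hW y).1 z
        rw [abs_le]
        constructor <;> linarith
    _ = 2 := by rw [Finset.sum_add_distrib, (hW x).2, (hW y).2]; norm_num

theorem sqrt_two_mul_eq (hσ : 0 < σ) (hη : 0 < η)
    (hτ : τ = σ ^ 4 * η ^ 2 / (8 * (Fintype.card X : ℝ) ^ 4 * (Fintype.card Z : ℝ) ^ 2)) :
    Real.sqrt (2 * τ) = σ ^ 2 * η / (2 * (Fintype.card X : ℝ) ^ 2 * Fintype.card Z) := by
  rw [Real.sqrt_eq_iff_eq_sq (by rw [hτ]; positivity) (by positivity), hτ]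
  rw [div_pow]
  by_cases hX : (Fintype.card X : ℝ) = 0
  · simp [hX]
  by_cases hZ : (Fintype.card Z : ℝ) = 0
  · simp [hZ]
  field_simp
  ring

/-- The second inequality is the room needed in `sum_condTypical_le_of_far` with both `t` and `ε`
equal to `√(2τ)`. The first makes squares of `√(2τ)` negligible against `√(2τ)` itself. -/
theorem sqrt_two_mul_le [Nontrivial X] [Nonempty Z] (hσ : 0 < σ) (hσ' : σ ≤ 1 / 2) (hη : 0 < η)
    (hη' : η ≤ 2)
    (hτ : τ = σ ^ 4 * η ^ 2 / (8 * (Fintype.card X : ℝ) ^ 4 * (Fintype.card Z : ℝ) ^ 2)) :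
    Real.sqrt (2 * τ) ≤ 1 ∧
      2 * Real.sqrt (2 * τ) ≤ σ * η / (Fintype.card X * Fintype.card Z) := by
  have hX : (2 : ℝ) ≤ Fintype.card X := by
    exact_mod_cast Fintype.one_lt_card_iff_nontrivial.2 ‹_›
  have hZ : (1 : ℝ) ≤ Fintype.card Z := by exact_mod_cast Fintype.card_pos
  have hA : 0 < σ * η / (Fintype.card X * Fintype.card Z) := by positivity
  have hr : Real.sqrt (2 * τ) =
      σ * η / (Fintype.card X * Fintype.card Z) * (σ / (2 * Fintype.card X)) := by
    rw [sqrt_two_mul_eq hσ hη hτ]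
    field_simp
  have h1 : σ / (2 * Fintype.card X) ≤ 1 / 2 := by
    rw [div_le_iff₀ (by positivity)]
    nlinarith
  have h2 : σ * η / (Fintype.card X * Fintype.card Z) ≤ 1 := by
    rw [div_le_one (by positivity)]
    nlinarith
  constructor <;> rw [hr] <;> nlinarith

/-- For distance at least `2 σ n` the one-shot protocol is binding. -/
theorem oneShot_isBinding [Nonempty X] [Nonempty Z] (hn : 0 < n)
    (hW : ∀ x, W x ∈ stdSimplex ℝ Z) (hσ : 0 < σ) (hσ' : σ ≤ 1 / 2) (hη : 0 < η)
    (hsep : Separated W η)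
    (hτ : τ = σ ^ 4 * η ^ 2 / (8 * (Fintype.card X : ℝ) ^ 4 * (Fintype.card Z : ℝ) ^ 2))
    {K L : ℕ} (hL : 0 < L) {ξ : Fin K → Fin L → Fin n → X} (hξ : CodeSpread σ ξ) :
    (oneShot W (Real.sqrt (2 * τ)) hL ξ).IsBinding W (2 * (Fintype.card X : ℝ) *
      (Fintype.card Z : ℝ) * (2 : ℝ) ^ (-(2 * (n : ℝ) * τ ^ 2))) := by
  have hX : (1 : ℝ) ≤ Fintype.card X := by exact_mod_cast Fintype.card_pos
  have hZ : (1 : ℝ) ≤ Fintype.card Z := by exact_mod_cast Fintype.card_pos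
  have hnr : (0 : ℝ) < n := by exact_mod_cast hn
  have hτ0 : 0 ≤ τ := by rw [hτ]; positivity
  have hsq : Real.sqrt (2 * τ) ^ 2 = 2 * τ := Real.sq_sqrt (by positivity)
  constructor
  · refine oneShot_isSound hL ξ hW fun w => ?_
    rcases le_or_gt τ 1 with h1 | h1
    · refine (sum_not_condTypical_le hn hW w (Real.sqrt_nonneg _)).trans ?_
      refine mul_le_mul_of_nonneg_left (exp_neg_le_two_rpow_neg (by positivity) ?_)
        (by positivity)
      rw [hsq]
      have : τ ^ 2 ≤ 2 * τ := by nlinarith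
      gcongr
    -- Large `τ` does occur: on a one-letter alphabet separation is vacuous and `η` is unbounded.
    -- Then the tolerance `√(2τ) n` exceeds `n`, so every output of positive probability is typical.
    · rw [Finset.sum_eq_zero]
      · positivity
      intro v _
      by_cases h0 : channelPow W w v = 0
      · simp [h0]
      rw [if_pos]
      refine mem_condTypical_of_forall h0 fun x z => (abs_pairCount_sub_le hW x z w v).trans ?_
      refine le_mul_of_one_le_left hnr.le ?_
      rw [Real.one_le_sqrt]
      linarith
  · refine oneShot_isCheatProof hL hW hξ fun u w hd => ?_
    -- Two words at positive distance yield two different letters, and hence `η ≤ 2`.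
    have hwu : w ≠ u := by
      rintro rfl
      rw [hammingDist_self] at hd
      have := mul_pos hσ hnr
      push_cast at hd
      linarith
    obtain ⟨i, hi⟩ := Function.ne_iff.1 hwu
    have : Nontrivial X := ⟨⟨_, _, hi⟩⟩
    obtain ⟨h1, h2⟩ := sqrt_two_mul_le hσ hσ' hη (le_two_of_separated hW hsep) hτ
    refine (sum_condTypical_le_of_far hn hW hσ hη hsep hd (Real.sqrt_nonneg (2 * τ))
      (by linarith)).trans ?_
    have h3 : Real.exp (-(2 * n * Real.sqrt (2 * τ) ^ 2)) ≤ (2 : ℝ) ^ (-(2 * (n : ℝ) * τ ^ 2)) := by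
      refine exp_neg_le_two_rpow_neg (by positivity) ?_
      have : τ ≤ 1 := by nlinarith [Real.sqrt_nonneg (2 * τ)]
      rw [hsq]
      have : τ ^ 2 ≤ 2 * τ := by nlinarith
      gcongr
    have h4 : 1 ≤ (Fintype.card X : ℝ) * Fintype.card Z := one_le_mul_of_one_le_of_one_le hX hZ
    have h5 : (0 : ℝ) < (2 : ℝ) ^ (-(2 * (n : ℝ) * τ ^ 2)) := by positivity
    nlinarith

end Parameters

/-! ### Entropy inequalities -/

/-- Gibbs' inequality. -/
theorem sum_mul_logb_div_nonneg {α : Type*} [Fintype α] {p q : α → ℝ} (hp : p ∈ stdSimplex ℝ α)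
    (hq : ∀ x, 0 ≤ q x) (hq1 : ∑ x, q x ≤ 1) (hpq : ∀ x, q x = 0 → p x = 0) :
    0 ≤ ∑ x, p x * (Real.logb 2 (p x) - Real.logb 2 (q x)) := by
  have hlog : 0 < Real.log 2 := Real.log_pos one_lt_two
  have h : ∀ x, (p x - q x) / Real.log 2 ≤ p x * (Real.logb 2 (p x) - Real.logb 2 (q x)) := by
    intro x
    rw [Real.logb, Real.logb, ← sub_div, ← mul_div_assoc]
    refine div_le_div_of_nonneg_right ?_ hlog.le
    by_cases hpx : p x = 0
    · simpa [hpx] using hq x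
    have hp0 : 0 < p x := lt_of_le_of_ne (hp.1 x) (Ne.symm hpx)
    have hq0 : 0 < q x := lt_of_le_of_ne (hq x) fun h => hpx (hpq x h.symm)
    have h1 := Real.log_le_sub_one_of_pos (div_pos hq0 hp0)
    rw [Real.log_div hq0.ne' hp0.ne'] at h1
    have h2 := mul_le_mul_of_nonneg_left h1 hp0.le
    have h3 : p x * (q x / p x - 1) = q x - p x := by field_simp
    nlinarith
  refine le_trans ?_ (Finset.sum_le_sum fun x _ => h x)
  rw [← Finset.sum_div, Finset.sum_sub_distrib, hp.2]
  exact div_nonneg (by linarith) hlog.le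

theorem joint_mul_logb {X Z : Type*} (P : X → ℝ) (W : X → Z → ℝ) (x : X) (z : Z) : P x * W x z * Real.logb 2 (P x * W x z) =
    P x * W x z * Real.logb 2 (P x) + P x * W x z * Real.logb 2 (W x z) := by
  by_cases h1 : P x = 0
  · simp [h1]
  by_cases h2 : W x z = 0
  · simp [h2]
  rw [Real.logb_mul h1 h2, mul_add]

section Information

variable {X Z : Type*} [Fintype X] [Fintype Z] {P : X → ℝ} {W : X → Z → ℝ}

/-- The mutual information between the input and the output of the channel. -/
def mutualInformation (P : X → ℝ) (W : X → Z → ℝ) : ℝ :=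
  ∑ xz : X × Z, P xz.1 * W xz.1 xz.2 *
    (Real.logb 2 (W xz.1 xz.2) - Real.logb 2 (outputDistr P W xz.2))

theorem joint_mem_stdSimplex (hW : ∀ x, W x ∈ stdSimplex ℝ Z) (hP : P ∈ stdSimplex ℝ X) :
    (fun xz : X × Z => P xz.1 * W xz.1 xz.2) ∈ stdSimplex ℝ (X × Z) := by
  refine ⟨fun xz => mul_nonneg (hP.1 _) ((hW _).1 _), ?_⟩
  rw [Fintype.sum_prod_type, ← hP.2]
  refine Finset.sum_congr rfl fun x _ => ?_
  dsimp only
  rw [← Finset.mul_sum, (hW x).2, mul_one]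

theorem outputDistr_mem_stdSimplex (hW : ∀ x, W x ∈ stdSimplex ℝ Z) (hP : P ∈ stdSimplex ℝ X) :
    outputDistr P W ∈ stdSimplex ℝ Z := by
  refine ⟨fun z => Finset.sum_nonneg fun x _ => mul_nonneg (hP.1 x) ((hW x).1 z), ?_⟩
  have h := (joint_mem_stdSimplex hW hP).2
  rw [Fintype.sum_prod_type, Finset.sum_comm] at h
  exact h

theorem joint_eq_zero_of_outputDistr (hW : ∀ x, W x ∈ stdSimplex ℝ Z) (hP : P ∈ stdSimplex ℝ X)
    {x : X} {z : Z} (h : outputDistr P W z = 0) : P x * W x z = 0 :=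
  (Finset.sum_eq_zero_iff_of_nonneg fun x _ => mul_nonneg (hP.1 x) ((hW x).1 z)).1 h x
    (Finset.mem_univ x)

theorem sum_joint_fst (hW : ∀ x, W x ∈ stdSimplex ℝ Z) (f : X → ℝ) :
    ∑ xz : X × Z, P xz.1 * W xz.1 xz.2 * f xz.1 = ∑ x, P x * f x := by
  rw [Fintype.sum_prod_type]
  refine Finset.sum_congr rfl fun x _ => ?_
  dsimp only
  rw [← Finset.sum_mul, ← Finset.mul_sum, (hW x).2, mul_one]

theorem sum_joint_snd (f : Z → ℝ) :
    ∑ xz : X × Z, P xz.1 * W xz.1 xz.2 * f xz.2 = ∑ z, outputDistr P W z * f z := by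
  rw [Fintype.sum_prod_type, Finset.sum_comm]
  refine Finset.sum_congr rfl fun z _ => ?_
  dsimp only
  rw [← Finset.sum_mul, outputDistr]

/-- This is the form in which the rate arises: about `2^{nH(X)}` typical words, spent in blocks of
about `2^{nI}`. -/
theorem equivocation_eq (hW : ∀ x, W x ∈ stdSimplex ℝ Z) :
    equivocation P W = shannonEntropy P - mutualInformation P W := by
  simp only [equivocation, shannonEntropy, mutualInformation, joint_mul_logb, mul_sub,
    Finset.sum_add_distrib, Finset.sum_sub_distrib]
  rw [sum_joint_fst hW fun x => Real.logb 2 (P x),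
    sum_joint_snd fun z => Real.logb 2 (outputDistr P W z)]
  ring

/-- Gibbs' inequality for the joint law against the product of its marginals. -/
theorem mutualInformation_nonneg (hW : ∀ x, W x ∈ stdSimplex ℝ Z) (hP : P ∈ stdSimplex ℝ X) :
    0 ≤ mutualInformation P W := by
  have hQ := outputDistr_mem_stdSimplex hW hP
  have h := sum_mul_logb_div_nonneg (q := fun xz : X × Z => P xz.1 * outputDistr P W xz.2)
    (joint_mem_stdSimplex hW hP) (fun xz => mul_nonneg (hP.1 _) (hQ.1 _))
    (le_of_eq (by
      rw [Fintype.sum_prod_type, ← hP.2]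
      refine Finset.sum_congr rfl fun x _ => ?_
      dsimp only
      rw [← Finset.mul_sum, hQ.2, mul_one]))
    (fun xz h => by
      rcases mul_eq_zero.1 h with h | h
      · simp [h]
      · exact joint_eq_zero_of_outputDistr hW hP h)
  refine h.trans_eq (Finset.sum_congr rfl fun xz _ => ?_)
  by_cases h0 : P xz.1 * W xz.1 xz.2 = 0
  · simp [h0]
  have h1 := left_ne_zero_of_mul h0
  have h2 := right_ne_zero_of_mul h0
  have h3 : outputDistr P W xz.2 ≠ 0 := fun h => h0 (joint_eq_zero_of_outputDistr hW hP h)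
  rw [Real.logb_mul h1 h2, Real.logb_mul h1 h3]
  ring

/-- Gibbs' inequality against the uniform distribution bounds `H(X)`, and `I ≥ 0`. -/
theorem equivocation_le [Nonempty X] (hW : ∀ x, W x ∈ stdSimplex ℝ Z) (hP : P ∈ stdSimplex ℝ X) :
    equivocation P W ≤ Real.logb 2 (Fintype.card X) := by
  have hX : (0 : ℝ) < Fintype.card X := by exact_mod_cast Fintype.card_pos
  have h := sum_mul_logb_div_nonneg (q := fun _ : X => (1 : ℝ) / Fintype.card X) hP
    (fun x => by positivity) (by simp [hX.ne']) (fun x h => by simp at h)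
  simp only [mul_sub, Finset.sum_sub_distrib, ← Finset.sum_mul, hP.2, one_mul, one_div,
    Real.logb_inv] at h
  have h2 := mutualInformation_nonneg hW hP
  rw [equivocation_eq hW, shannonEntropy]
  linarith

end Information

/-! ### Hamming balls -/

/-- A Hamming ball of radius `p n` has at most `2 ^ (n (h(p) + p log |X|))` elements. -/
theorem card_hammingBall_le {X : Type*} [Fintype X] [Nonempty X] {n : ℕ} (u : Fin n → X) {p : ℝ}
    (hp0 : 0 < p) (hp1 : p ≤ 1) :
    ((Finset.univ.filter fun w : Fin n → X => (hammingDist u w : ℝ) < p * n).card : ℝ) ≤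
      (2 : ℝ) ^ ((n : ℝ) * (shannonEntropy ![p, 1 - p] + p * Real.logb 2 (Fintype.card X))) := by
  have hX : (1 : ℝ) ≤ Fintype.card X := by exact_mod_cast Fintype.card_pos
  set r : ℝ := (Fintype.card X : ℝ) with hr
  have hent : shannonEntropy ![p, 1 - p] =
      -(p * Real.logb 2 p) - (1 - p) * Real.logb 2 (1 - p) := by
    simp [shannonEntropy]
    ring
  rcases le_or_gt p ((1 - p) * r) with hc | hc
  · have hp1' : 0 < 1 - p := by
      by_contra! h
      nlinarith
    -- Chernoff bound for the ball: its indicator is at most `s ^ (d - p n)` when `s ≤ 1`, where `d`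
    -- is the distance. This `s` satisfies `1 + r s = 1 / (1 - p)`, which makes the resulting bound
    -- exactly the claimed power of two.
    set s : ℝ := p / ((1 - p) * r) with hs
    have hs0 : 0 < s := by positivity
    have hs1 : s ≤ 1 := (div_le_one (by positivity)).2 hc
    have hone : ∑ w : Fin n → X, s ^ hammingDist u w = (1 + (r - 1) * s) ^ n := by
      have h1 : ∀ w : Fin n → X, s ^ hammingDist u w = ∏ i, if u i = w i then 1 else s := by
        intro w
        rw [Finset.prod_ite, Finset.prod_const_one, one_mul, Finset.prod_const]
        rfl
      have h2 := Finset.prod_univ_sum (fun _ : Fin n => (Finset.univ : Finset X))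
        (fun i x => if u i = x then (1 : ℝ) else s)
      rw [Fintype.piFinset_univ] at h2
      rw [Finset.sum_congr rfl fun w _ => h1 w, ← h2]
      have h3 : ∀ y : X, ∑ x, (if y = x then (1 : ℝ) else s) = 1 + (r - 1) * s := by
        intro y
        have : ∀ x, (if y = x then (1 : ℝ) else s) = s + if y = x then 1 - s else 0 := by
          intro x; split_ifs <;> ring
        rw [Finset.sum_congr rfl fun x _ => this x, Finset.sum_add_distrib]
        simp [← hr]
        ring
      rw [Finset.prod_congr rfl fun i _ => h3 (u i)]
      simp
    have hcard : ((Finset.univ.filter fun w : Fin n → X => (hammingDist u w : ℝ) < p * n).card : ℝ)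
        ≤ s ^ (-(p * n)) * (1 + (r - 1) * s) ^ n := by
      rw [← hone, Finset.mul_sum, Finset.cast_card, Finset.sum_filter]
      refine Finset.sum_le_sum fun w _ => ?_
      split_ifs with h
      · rw [← Real.rpow_natCast, ← Real.rpow_add hs0]
        exact Real.one_le_rpow_of_pos_of_le_one_of_nonpos hs0 hs1 (by linarith)
      · positivity
    refine hcard.trans ?_
    have h1 : 1 + (r - 1) * s ≤ (1 - p)⁻¹ := by
      have : (1 - p)⁻¹ = 1 + r * s := by
        rw [hs]; field_simp; ring
      rw [this]
      linarith
    have h0 : 0 ≤ 1 + (r - 1) * s := by nlinarith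
    refine (mul_le_mul_of_nonneg_left (pow_le_pow_left₀ h0 h1 n) (by positivity)).trans_eq ?_
    rw [← Real.logb_injOn_pos one_lt_two |>.eq_iff (Set.mem_Ioi.2 (by positivity))
      (Set.mem_Ioi.2 (by positivity)), Real.logb_mul (by positivity) (by positivity),
      Real.logb_rpow_eq_mul_logb_of_pos hs0, Real.logb_pow, Real.logb_inv,
      Real.logb_rpow two_pos (by norm_num), hs, Real.logb_div hp0.ne' (by positivity),
      Real.logb_mul hp1'.ne' (by positivity), hent]
    ring
  -- Here `s` would exceed `1`, but `r < 1 / (1 - p)` already makes the claimed bound at least `r ^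
  -- n`, the number of all words.
  · have h1 : ((Finset.univ.filter fun w : Fin n → X => (hammingDist u w : ℝ) < p * n).card : ℝ)
        ≤ r ^ n := by
      have := Finset.card_le_univ
        (Finset.univ.filter fun w : Fin n → X => (hammingDist u w : ℝ) < p * n)
      rw [Fintype.card_fun, Fintype.card_fin] at this
      rw [hr]
      exact_mod_cast this
    refine h1.trans ?_
    have h2 : r ^ n = (2 : ℝ) ^ ((n : ℝ) * Real.logb 2 r) := by
      rw [mul_comm, Real.rpow_mul two_pos.le, Real.rpow_logb two_pos (by norm_num) (by linarith),
        Real.rpow_natCast]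
    rw [h2]
    refine Real.rpow_le_rpow_of_exponent_le one_le_two
      (mul_le_mul_of_nonneg_left ?_ (Nat.cast_nonneg n))
    have h3 : p * Real.logb 2 p ≤ 0 :=
      mul_nonpos_of_nonneg_of_nonpos hp0.le (Real.logb_nonpos one_lt_two hp0.le hp1)
    have h4 : (1 - p) * Real.logb 2 r ≤ -((1 - p) * Real.logb 2 (1 - p)) := by
      rcases eq_or_lt_of_le hp1 with h | h
      · simp [h]
      have h5 : 0 < 1 - p := by linarith
      rw [← mul_neg, ← Real.logb_inv]
      refine mul_le_mul_of_nonneg_left (Real.logb_le_logb_of_le one_lt_two (by linarith) ?_) h5.le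
      rw [← one_div, le_div_iff₀ h5]
      linarith
    rw [hent]
    linarith

/-! ### Greedy soft covering -/

theorem sum_biUnion_le {ι α : Type*} (s : Finset ι) (t : ι → Finset α) {f : α → ℝ}
    (hf : ∀ x, 0 ≤ f x) : ∑ x ∈ s.biUnion t, f x ≤ ∑ i ∈ s, ∑ x ∈ t i, f x := by
  induction s using Finset.induction_on with
  | empty => simp
  | insert i s hi ih =>
    rw [Finset.biUnion_insert, Finset.sum_insert hi]
    have h1 := Finset.sum_union_inter (s₁ := t i) (s₂ := s.biUnion t) (f := f)
    have h2 : 0 ≤ ∑ x ∈ t i ∩ s.biUnion t, f x := Finset.sum_nonneg fun x _ => hf x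
    linarith

/-- Dependent choice of a finite initial segment of a sequence. -/
theorem exists_seq_of_step {Ω : Type*} [Nonempty Ω] {R : ℕ → (ℕ → Ω) → Ω → Prop}
    (hR : ∀ k w w' x, (∀ j < k, w j = w' j) → R k w x → R k w' x) (N : ℕ)
    (hex : ∀ k < N, ∀ w, ∃ x, R k w x) : ∃ w : ℕ → Ω, ∀ k < N, R k w (w k) := by
  induction N with
  | zero => exact ⟨fun _ => Classical.arbitrary Ω, fun k hk => absurd hk (Nat.not_lt_zero k)⟩
  | succ N ih =>
    obtain ⟨w, hw⟩ := ih fun k hk => hex k (hk.trans N.lt_succ_self)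
    obtain ⟨x, hx⟩ := hex N N.lt_succ_self w
    refine ⟨Function.update w N x, fun k hk => ?_⟩
    rcases Nat.lt_succ_iff_lt_or_eq.1 hk with h | rfl
    · rw [Function.update_of_ne h.ne]
      exact hR k w _ _ (fun j hj => (Function.update_of_ne (hj.trans h).ne _ _).symm) (hw k h)
    · rw [Function.update_self]
      exact hR k w _ _ (fun j hj => (Function.update_of_ne hj.ne _ _).symm) hx

/-- If vectors `d x` of length at most `√B` have a small weighted mean, then one of them lengthens
a given vector `e` by little. -/
theorem exists_norm_add_sq_le {Ω E : Type*} [NormedAddCommGroup E] [InnerProductSpace ℝ E]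
    {G : Finset Ω} {π : Ω → ℝ} {d : Ω → E} {b B : ℝ} (hπ : ∀ x, 0 ≤ π x)
    (hm : 1 / 2 ≤ ∑ x ∈ G, π x) (hd : ‖∑ x ∈ G, π x • d x‖ ≤ b) (hB : ∀ x ∈ G, ‖d x‖ ^ 2 ≤ B)
    (e : E) : ∃ x ∈ G, ‖e + d x‖ ^ 2 ≤ ‖e‖ ^ 2 + 4 * b * ‖e‖ + B := by
  -- Average the squared lengths over `G`: the cross term is at most `2 b ‖e‖`, and dividing by a
  -- total weight of at least `1 / 2` turns it into `4 b ‖e‖`.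
  by_contra! hc
  have h1 : ∑ x ∈ G, π x * ‖e + d x‖ ^ 2 ≤
      (∑ x ∈ G, π x) * ‖e‖ ^ 2 + 2 * (b * ‖e‖) + (∑ x ∈ G, π x) * B := by
    have h2 : ∀ x, π x * ‖e + d x‖ ^ 2 =
        π x * ‖e‖ ^ 2 + 2 * inner ℝ e (π x • d x) + π x * ‖d x‖ ^ 2 := by
      intro x
      rw [norm_add_sq_real, inner_smul_right]
      ring
    rw [Finset.sum_congr rfl fun x _ => h2 x, Finset.sum_add_distrib, Finset.sum_add_distrib,
      ← Finset.mul_sum, ← inner_sum, ← Finset.sum_mul]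
    have h3 := real_inner_le_norm e (∑ x ∈ G, π x • d x)
    have h4 := mul_le_mul_of_nonneg_left hd (norm_nonneg e)
    have h5 : ∑ x ∈ G, π x * ‖d x‖ ^ 2 ≤ (∑ x ∈ G, π x) * B := by
      rw [Finset.sum_mul]
      exact Finset.sum_le_sum fun x hx => mul_le_mul_of_nonneg_left (hB x hx) (hπ x)
    linarith
  have hb : 0 ≤ b * ‖e‖ := mul_nonneg ((norm_nonneg _).trans hd) (norm_nonneg e)
  have h2 : ∑ x ∈ G, π x * (‖e‖ ^ 2 + 4 * b * ‖e‖ + B) < ∑ x ∈ G, π x * ‖e + d x‖ ^ 2 := by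
    obtain ⟨x, hx, hx0⟩ := Finset.exists_ne_zero_of_sum_ne_zero (by linarith : ∑ x ∈ G, π x ≠ 0)
    exact Finset.sum_lt_sum (fun y hy => mul_le_mul_of_nonneg_left (hc y hy).le (hπ y))
      ⟨x, hx, mul_lt_mul_of_pos_left (hc x hx) (lt_of_le_of_ne (hπ x) hx0.symm)⟩
  rw [← Finset.sum_mul] at h2
  nlinarith

section Covering

variable {Ω Y : Type*} {π : Ω → ℝ} {V : Ω → Y → ℝ} {Q : Y → ℝ} {A γ : ℝ}

/-- The channel restricted to the outputs whose likelihood ratio is at most `A`. -/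
def truncated (V : Ω → Y → ℝ) (Q : Y → ℝ) (A : ℝ) (x : Ω) (y : Y) : ℝ :=
  if V x y ≤ A * Q y then V x y else 0

/-- The deviation of the truncated channel from `Q` in the geometry of `L²(1/Q)`. -/
def deviation (V : Ω → Y → ℝ) (Q : Y → ℝ) (A : ℝ) (x : Ω) : EuclideanSpace ℝ Y :=
  WithLp.toLp 2 fun y => truncated V Q A x y / Real.sqrt (Q y) - Real.sqrt (Q y)

theorem truncated_nonneg (hV : ∀ x y, 0 ≤ V x y) (x : Ω) (y : Y) : 0 ≤ truncated V Q A x y := by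
  unfold truncated; split_ifs; exacts [hV x y, le_rfl]

theorem truncated_le (hV : ∀ x y, 0 ≤ V x y) (x : Ω) (y : Y) : truncated V Q A x y ≤ V x y := by
  unfold truncated; split_ifs; exacts [le_rfl, hV x y]

theorem truncated_le_mul (hA : 0 ≤ A) (hQ : ∀ y, 0 ≤ Q y) (x : Ω) (y : Y) :
    truncated V Q A x y ≤ A * Q y := by
  unfold truncated; split_ifs with h; exacts [h, mul_nonneg hA (hQ y)]

variable [Fintype Y]

/-- With `t` the truncated value, a coordinate squares to `t²/Q - 2t + Q`, and `t ≤ A Q` gives `t²/Q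
≤ A t`. The truncation is there to make this length finite and controlled. -/
theorem norm_deviation_sq_le (hV : ∀ x, V x ∈ stdSimplex ℝ Y) (hQ : Q ∈ stdSimplex ℝ Y)
    (hA : 0 ≤ A) (x : Ω) : ‖deviation V Q A x‖ ^ 2 ≤ A + 1 := by
  rw [EuclideanSpace.real_norm_sq_eq]
  have h : ∀ y, (deviation V Q A x) y ^ 2 ≤ A * V x y + Q y := by
    intro y
    have h0 := truncated_nonneg (Q := Q) (A := A) (fun x => (hV x).1) x y
    have h1 := truncated_le (Q := Q) (A := A) (fun x => (hV x).1) x y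
    have h2 := truncated_le_mul (V := V) hA hQ.1 x y
    change (truncated V Q A x y / Real.sqrt (Q y) - Real.sqrt (Q y)) ^ 2 ≤ _
    rcases eq_or_lt_of_le (hQ.1 y) with hq | hq
    · rw [← hq]
      simpa using mul_nonneg hA ((hV x).1 y)
    · have hs : 0 < Real.sqrt (Q y) := Real.sqrt_pos.2 hq
      have h3 : (truncated V Q A x y / Real.sqrt (Q y) - Real.sqrt (Q y)) ^ 2 =
          truncated V Q A x y * (truncated V Q A x y / Q y) - 2 * truncated V Q A x y + Q y := by
        rw [sub_sq, div_pow, Real.sq_sqrt hq.le]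
        field_simp
      have h4 : truncated V Q A x y / Q y ≤ A := (div_le_iff₀ hq).2 h2
      have h5 := mul_le_mul_of_nonneg_left h4 h0
      have h6 := mul_le_mul_of_nonneg_left h1 hA
      rw [h3]
      linarith
  refine (Finset.sum_le_sum fun y _ => h y).trans_eq ?_
  rw [Finset.sum_add_distrib, ← Finset.mul_sum, (hV x).2, hQ.2, mul_one]

/-- The total variation distance from `Q` is controlled by the sum of the deviations. -/
theorem sum_abs_average_sub_le (hV : ∀ x, V x ∈ stdSimplex ℝ Y) (hQ : Q ∈ stdSimplex ℝ Y)
    (hA : 0 ≤ A) {L : ℕ} (hL : 0 < L) (x : Fin L → Ω) :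
    ∑ y, |1 / (L : ℝ) * ∑ μ, V (x μ) y - Q y| ≤
      2 * (‖∑ μ, deviation V Q A (x μ)‖ / L) := by
  have hLr : (0 : ℝ) < L := by exact_mod_cast hL
  set e := ∑ μ, deviation V Q A (x μ) with he
  set T : Y → ℝ := fun y => 1 / (L : ℝ) * ∑ μ, truncated V Q A (x μ) y with hT
  have hTQ : ∀ y, T y - Q y = 1 / (L : ℝ) * (Real.sqrt (Q y) * e y) := by
    intro y
    have h1 : e y = ∑ μ, (truncated V Q A (x μ) y / Real.sqrt (Q y) - Real.sqrt (Q y)) := by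
      rw [he, WithLp.ofLp_sum, Finset.sum_apply]
      rfl
    rw [h1, Finset.mul_sum]
    have h2 : ∀ μ, Real.sqrt (Q y) *
        (truncated V Q A (x μ) y / Real.sqrt (Q y) - Real.sqrt (Q y)) =
        truncated V Q A (x μ) y - Q y := by
      intro μ
      rw [mul_sub, Real.mul_self_sqrt (hQ.1 y)]
      rcases eq_or_lt_of_le (hQ.1 y) with hq | hq
      · have h3 := truncated_le_mul (V := V) hA hQ.1 (x μ) y
        have h4 := truncated_nonneg (Q := Q) (A := A) (fun x => (hV x).1) (x μ) y
        rw [← hq, mul_zero] at h3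
        rw [le_antisymm h3 h4]
        simp
      · rw [mul_div_cancel₀ _ (Real.sqrt_pos.2 hq).ne']
    rw [Finset.sum_congr rfl fun μ _ => h2 μ, Finset.sum_sub_distrib]
    simp only [hT, Finset.sum_const, Finset.card_univ, Fintype.card_fin, nsmul_eq_mul]
    field_simp
  have h1 : ∑ y, |T y - Q y| ≤ ‖e‖ / L := by
    -- Cauchy–Schwarz, using that `Q` has total mass one.
    have h2 : ∑ y, Real.sqrt (Q y) * |e y| ≤ ‖e‖ := by
      have h3 := Real.sum_mul_le_sqrt_mul_sqrt Finset.univ (fun y => Real.sqrt (Q y))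
        fun y => |e y|
      refine h3.trans_eq ?_
      simp only [Real.sq_sqrt (hQ.1 _), hQ.2, sq_abs]
      rw [Real.sqrt_one, one_mul, EuclideanSpace.norm_eq]
      simp
    have h4 : ∀ y, |T y - Q y| = 1 / (L : ℝ) * (Real.sqrt (Q y) * |e y|) := by
      intro y
      rw [hTQ, abs_mul, abs_mul, abs_of_pos (by positivity : (0 : ℝ) < 1 / L),
        abs_of_nonneg (Real.sqrt_nonneg _)]
    rw [Finset.sum_congr rfl fun y _ => h4 y, ← Finset.mul_sum, one_div, div_eq_inv_mul]
    exact mul_le_mul_of_nonneg_left h2 (by positivity)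
  have h2 : ∀ y, T y ≤ 1 / (L : ℝ) * ∑ μ, V (x μ) y := fun y =>
    mul_le_mul_of_nonneg_left
      (Finset.sum_le_sum fun μ _ => truncated_le (fun x => (hV x).1) (x μ) y) (by positivity)
  have h3 : ∑ y, 1 / (L : ℝ) * ∑ μ, V (x μ) y = 1 := by
    rw [← Finset.mul_sum, Finset.sum_comm, Finset.sum_congr rfl fun μ _ => (hV (x μ)).2]
    simp [hLr.ne']
  -- The full average dominates the truncated one `T`, so where it falls below `Q` the deficit is at
  -- most `|T - Q|`. The signed differences sum to zero, so the mass lost by truncation needs no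
  -- separate estimate.
  have h4 : ∀ y, |1 / (L : ℝ) * ∑ μ, V (x μ) y - Q y| ≤
      (1 / (L : ℝ) * ∑ μ, V (x μ) y - Q y) + 2 * |T y - Q y| := by
    intro y
    have h5 := neg_abs_le (T y - Q y)
    have h6 := h2 y
    rw [abs_le]
    constructor <;> linarith [abs_nonneg (T y - Q y)]
  refine (Finset.sum_le_sum fun y _ => h4 y).trans ?_
  rw [Finset.sum_add_distrib, Finset.sum_sub_distrib, h3, hQ.2, ← Finset.mul_sum]
  linarith

variable [Fintype Ω]

/-- Let `p ≤ Q` be the retained output mass and `m` the weight of `G`. The mean has coordinates `(p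
- m Q)/√Q`, and `|p - m Q|` is bounded both by `Q` and by `(Q - p) + (1 - m) Q`. Hence its square
over `Q` is at most the latter, which sums to at most `2γ`. -/
theorem norm_sum_smul_deviation_le (hπ : π ∈ stdSimplex ℝ Ω) (hV : ∀ x, V x ∈ stdSimplex ℝ Y)
    (hQ : ∀ y, Q y = ∑ x, π x * V x y) {G : Finset Ω}
    (hG : 1 - γ ≤ ∑ x ∈ G, π x * ∑ y, truncated V Q A x y) :
    1 - γ ≤ ∑ x ∈ G, π x ∧ ‖∑ x ∈ G, π x • deviation V Q A x‖ ≤ Real.sqrt (2 * γ) := by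
  have ht0 := truncated_nonneg (Q := Q) (A := A) (fun x => (hV x).1)
  have ht1 := truncated_le (Q := Q) (A := A) (fun x => (hV x).1)
  have hQ1 : ∑ y, Q y = 1 := by
    rw [Finset.sum_congr rfl fun y _ => hQ y, Finset.sum_comm, ← hπ.2]
    exact Finset.sum_congr rfl fun x _ => by rw [← Finset.mul_sum, (hV x).2, mul_one]
  set m := ∑ x ∈ G, π x with hm
  have hm0 : 0 ≤ m := Finset.sum_nonneg fun x _ => hπ.1 x
  have hm1 : m ≤ 1 := by
    rw [← hπ.2]
    exact Finset.sum_le_univ_sum_of_nonneg hπ.1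
  have hγm : 1 - γ ≤ m := hG.trans (Finset.sum_le_sum fun x _ =>
    mul_le_of_le_one_right (hπ.1 x) ((Finset.sum_le_sum fun y _ => ht1 x y).trans_eq (hV x).2))
  refine ⟨hγm, ?_⟩
  set p : Y → ℝ := fun y => ∑ x ∈ G, π x * truncated V Q A x y with hp
  have hp0 : ∀ y, 0 ≤ p y := fun y =>
    Finset.sum_nonneg fun x _ => mul_nonneg (hπ.1 x) (ht0 x y)
  have hpQ : ∀ y, p y ≤ Q y := by
    intro y
    rw [hQ]
    exact (Finset.sum_le_sum fun x _ => mul_le_mul_of_nonneg_left (ht1 x y) (hπ.1 x)).trans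
      (Finset.sum_le_univ_sum_of_nonneg fun x => mul_nonneg (hπ.1 x) ((hV x).1 y))
  have hpsum : 1 - γ ≤ ∑ y, p y := by
    refine hG.trans_eq ?_
    rw [hp, Finset.sum_comm]
    exact Finset.sum_congr rfl fun x _ => Finset.mul_sum _ _ _
  have hcoord : ∀ y, (∑ x ∈ G, π x • deviation V Q A x) y =
      p y / Real.sqrt (Q y) - m * Real.sqrt (Q y) := by
    intro y
    rw [WithLp.ofLp_sum, Finset.sum_apply, hp, hm, Finset.sum_mul, Finset.sum_div,
      ← Finset.sum_sub_distrib]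
    refine Finset.sum_congr rfl fun x _ => ?_
    change π x * (truncated V Q A x y / Real.sqrt (Q y) - Real.sqrt (Q y)) = _
    ring
  apply Real.le_sqrt_of_sq_le
  rw [EuclideanSpace.real_norm_sq_eq]
  have h : ∀ y, (∑ x ∈ G, π x • deviation V Q A x) y ^ 2 ≤ (Q y - p y) + (1 - m) * Q y := by
    intro y
    rw [hcoord]
    have hQ0 : 0 ≤ Q y := (hp0 y).trans (hpQ y)
    rcases eq_or_lt_of_le hQ0 with hq | hq
    · rw [← hq]
      have := hpQ y
      simp
      linarith
    · have hs : 0 < Real.sqrt (Q y) := Real.sqrt_pos.2 hq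
      have h1 : p y / Real.sqrt (Q y) - m * Real.sqrt (Q y) = (p y - m * Q y) / Real.sqrt (Q y) := by
        rw [sub_div, mul_div_assoc, Real.div_sqrt]
      rw [h1, div_pow, Real.sq_sqrt hQ0, div_le_iff₀ hq]
      have hmQ : m * Q y ≤ Q y := mul_le_of_le_one_left hQ0 hm1
      have hmQ0 : 0 ≤ m * Q y := mul_nonneg hm0 hQ0
      have h2 : |p y - m * Q y| ≤ Q y :=
        abs_le.2 ⟨by linarith [hp0 y], by linarith [hpQ y]⟩
      have h3 : |p y - m * Q y| ≤ (Q y - p y) + (1 - m) * Q y :=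
        abs_le.2 ⟨by linarith [hpQ y], by linarith [hpQ y]⟩
      rw [← sq_abs, sq]
      exact mul_le_mul h3 h2 (abs_nonneg _) ((abs_nonneg _).trans h3)
  refine (Finset.sum_le_sum fun y _ => h y).trans ?_
  rw [Finset.sum_add_distrib, Finset.sum_sub_distrib, ← Finset.mul_sum, hQ1]
  linarith

/-- Greedy soft covering: one can choose `K` blocks of `L` inputs such that no input is close to
an earlier one and that the uniform mixture of the outputs over every block approximates `Q`. -/
theorem exists_covering_blocks [Nonempty Ω] (hπ : π ∈ stdSimplex ℝ Ω)
    (hV : ∀ x, V x ∈ stdSimplex ℝ Y) (hQ : ∀ y, Q y = ∑ x, π x * V x y) (hA : 0 ≤ A)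
    {T : Finset Ω} {near : Ω → Ω → Prop} {γ₀ ν : ℝ} {K L : ℕ} (hL : 0 < L)
    (hT : 1 - γ₀ ≤ ∑ x ∈ T, π x * ∑ y, truncated V Q A x y)
    (hnear : ∀ u, ∑ x ∈ T.filter (near u), π x ≤ ν) (hν : 0 ≤ ν)
    (hγ : γ₀ + (K * L : ℕ) * ν ≤ γ) (hγ' : γ ≤ 1 / 2) :
    ∃ w : ℕ → Ω, (∀ k < K * L, ∀ j < k, ¬ near (w j) (w k)) ∧
      ∀ a < K, ∑ y, |1 / (L : ℝ) * ∑ μ : Fin L, V (w (a * L + μ)) y - Q y| ≤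
        2 * (2 * Real.sqrt (2 * γ) + Real.sqrt ((A + 1) / L)) := by
  have hQs : Q ∈ stdSimplex ℝ Y := by
    constructor
    · intro y
      rw [hQ]
      exact Finset.sum_nonneg fun x _ => mul_nonneg (hπ.1 x) ((hV x).1 y)
    · rw [Finset.sum_congr rfl fun y _ => hQ y, Finset.sum_comm, ← hπ.2]
      exact Finset.sum_congr rfl fun x _ => by rw [← Finset.mul_sum, (hV x).2, mul_one]
  set d := deviation V Q A
  set b := Real.sqrt (2 * γ)
  have hb : 0 ≤ b := Real.sqrt_nonneg _
  have hLr : (0 : ℝ) < L := by exact_mod_cast hL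
  -- The sum of the deviations already chosen in the block containing position `k`; it restarts at
  -- zero at every multiple of `L`.
  let e : ℕ → (ℕ → Ω) → EuclideanSpace ℝ Y := fun k w =>
    ∑ j ∈ Finset.range (k % L), d (w (k / L * L + j))
  have he : ∀ k w w', (∀ j < k, w j = w' j) → e k w = e k w' := by
    intro k w w' h
    refine Finset.sum_congr rfl fun j hj => ?_
    rw [h]
    have h1 := Nat.div_add_mod' k L
    have h2 := Finset.mem_range.1 hj
    omega
  obtain ⟨w, hw⟩ := exists_seq_of_step
    (R := fun k w x => (∀ j < k, ¬ near (w j) x) ∧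
      ‖e k w + d x‖ ^ 2 ≤ ‖e k w‖ ^ 2 + 4 * b * ‖e k w‖ + (A + 1))
    (by
      rintro k w w' x h ⟨h1, h2⟩
      refine ⟨fun j hj => by rw [← h j hj]; exact h1 j hj, ?_⟩
      rw [← he k w w' h]
      exact h2)
    (K * L)
    (by
      intro k hk w
      -- Removing the neighbourhoods of the fewer than `K L` earlier words costs at most `K L ν` of
      -- the weight.
      set G := T.filter fun x => ∀ j < k, ¬ near (w j) x with hGdef
      have hG : 1 - γ ≤ ∑ x ∈ G, π x * ∑ y, truncated V Q A x y := by
        have ht1 : ∀ x, π x * ∑ y, truncated V Q A x y ≤ π x := fun x =>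
          mul_le_of_le_one_right (hπ.1 x) ((Finset.sum_le_sum fun y _ =>
            truncated_le (fun x => (hV x).1) x y).trans_eq (hV x).2)
        have h1 := Finset.sum_filter_add_sum_filter_not T (fun x => ∀ j < k, ¬ near (w j) x)
          fun x => π x * ∑ y, truncated V Q A x y
        have h2 : ∑ x ∈ T.filter (fun x => ¬ ∀ j < k, ¬ near (w j) x),
            π x * ∑ y, truncated V Q A x y ≤ (K * L : ℕ) * ν := by
          calc _ ≤ ∑ x ∈ T.filter (fun x => ¬ ∀ j < k, ¬ near (w j) x), π x :=
                Finset.sum_le_sum fun x _ => ht1 x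
            _ ≤ ∑ x ∈ (Finset.range k).biUnion fun j => T.filter (near (w j)), π x := by
                refine Finset.sum_le_sum_of_subset_of_nonneg (fun x hx => ?_) fun x _ _ => hπ.1 x
                rw [Finset.mem_filter] at hx
                obtain ⟨hxT, hx⟩ := hx
                push Not at hx
                obtain ⟨j, hj, hjx⟩ := hx
                exact Finset.mem_biUnion.2 ⟨j, Finset.mem_range.2 hj,
                  Finset.mem_filter.2 ⟨hxT, hjx⟩⟩
            _ ≤ ∑ j ∈ Finset.range k, ∑ x ∈ T.filter (near (w j)), π x :=
                sum_biUnion_le _ _ hπ.1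
            _ ≤ ∑ _j ∈ Finset.range k, ν := Finset.sum_le_sum fun j _ => hnear (w j)
            _ = k * ν := by simp
            _ ≤ _ := mul_le_mul_of_nonneg_right (by exact_mod_cast hk.le) hν
        rw [← hGdef] at h1
        linarith
      obtain ⟨hm, hd⟩ := norm_sum_smul_deviation_le hπ hV hQ hG
      obtain ⟨x, hx, hxe⟩ := exists_norm_add_sq_le (B := A + 1) hπ.1 (by linarith) hd
        (fun x _ => norm_deviation_sq_le hV hQs hA x) (e k w)
      exact ⟨x, (Finset.mem_filter.1 hx).2, hxe⟩)
  refine ⟨w, fun k hk => (hw k hk).1, fun a ha => ?_⟩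
  -- The drift `2 b m` comes from the nonzero mean, the square root from adding nearly orthogonal
  -- vectors. Dividing by `L` at `m = L` gives the two terms of the bound.
  have hnorm : ∀ m ≤ L, ‖∑ j ∈ Finset.range m, d (w (a * L + j))‖ ≤
      2 * b * m + Real.sqrt (m * (A + 1)) := by
    intro m hm
    induction m with
    | zero => simp
    | succ m ih =>
      have ih := ih (Nat.le_of_succ_le hm)
      have hmL : m < L := hm
      have hk : a * L + m < K * L := by
        have : (a + 1) * L ≤ K * L := Nat.mul_le_mul_right L ha
        rw [add_mul, one_mul] at this
        omega
      have h1 := (hw _ hk).2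
      have hmod : (a * L + m) % L = m := by
        rw [Nat.mul_add_mod', Nat.mod_eq_of_lt hmL]
      have hdiv : (a * L + m) / L = a := by
        rw [mul_comm, Nat.mul_add_div hL, Nat.div_eq_of_lt hmL, add_zero]
      simp only [e, hmod, hdiv] at h1
      rw [Finset.sum_range_succ]
      set f := ∑ j ∈ Finset.range m, d (w (a * L + j))
      refine abs_le_of_sq_le_sq' ?_ (by positivity) |>.2
      refine h1.trans ?_
      set s := Real.sqrt (m * (A + 1)) with hs
      set s' := Real.sqrt ((m + 1 : ℕ) * (A + 1)) with hs'
      have hs0 : 0 ≤ s := Real.sqrt_nonneg _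
      have hss : s ≤ s' := Real.sqrt_le_sqrt (by push_cast; nlinarith)
      have hsq : s ^ 2 = m * (A + 1) := Real.sq_sqrt (by positivity)
      have hsq' : s' ^ 2 = (m + 1) * (A + 1) := by
        rw [hs', Real.sq_sqrt (by positivity)]; push_cast; rfl
      have hm0 : (0 : ℝ) ≤ m := Nat.cast_nonneg m
      have hf := norm_nonneg f
      have h2 : ‖f‖ ^ 2 ≤ (2 * b * m + s) ^ 2 := by gcongr
      have h3 : 4 * b * ‖f‖ ≤ 4 * b * (2 * b * m + s) := by gcongr
      have h4 : b * m * s ≤ b * m * s' := by gcongr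
      have h5 : b * s ≤ b * s' := by gcongr
      push_cast
      nlinarith [sq_nonneg b]
  have h1 := sum_abs_average_sub_le hV hQs hA hL fun μ : Fin L => w (a * L + μ)
  refine h1.trans (mul_le_mul_of_nonneg_left ?_ zero_le_two)
  rw [Fin.sum_univ_eq_sum_range fun j => deviation V Q A (w (a * L + j)), div_le_iff₀ hLr]
  refine (hnorm L le_rfl).trans_eq ?_
  have h2 : Real.sqrt (L * (A + 1)) = Real.sqrt ((A + 1) / L) * L := by
    rw [Real.sqrt_eq_iff_eq_sq (by positivity) (by positivity), mul_pow,
      Real.sq_sqrt (by positivity)]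
    field_simp
  rw [h2]
  ring

end Covering

/-! ### Typical inputs and outputs -/

/-- Input and output words together form a word of independent letter pairs, to which Hoeffding's
inequality applies. -/
theorem sum_words_pair {α β : Type*} [Fintype α] [Fintype β] {n : ℕ}
    (g : (Fin n → α) → (Fin n → β) → ℝ) :
    ∑ x, ∑ y, g x y = ∑ c : Fin n → α × β, g (fun i => (c i).1) fun i => (c i).2 := by
  rw [← Fintype.sum_prod_type' (f := g)]
  exact (Equiv.sum_comp (Equiv.arrowProdEquivProdArrow (Fin n) (fun _ => α) fun _ => β)
    fun q => g q.1 q.2).symm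

theorem sum_word_mul_channelPow {X Z : Type*} [Fintype X] {n : ℕ} (P : X → ℝ)
    (W : X → Z → ℝ) (z : Fin n → Z) :
    ∑ x : Fin n → X, (∏ i, P (x i)) * channelPow W x z = ∏ i, outputDistr P W (z i) := by
  have h := Finset.prod_univ_sum (fun _ : Fin n => (Finset.univ : Finset X))
    (fun i x => P x * W x (z i))
  rw [Fintype.piFinset_univ] at h
  simp only [outputDistr, channelPow, h, Finset.prod_mul_distrib]

theorem lt_logb_prod {α : Type*} {n : ℕ} {p : α → ℝ} {w : Fin n → α} (h0 : ∀ i, p (w i) ≠ 0) {c : ℝ}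
    (h : (2 : ℝ) ^ c < ∏ i, p (w i)) : c < ∑ i, Real.logb 2 (p (w i)) := by
  rw [← Real.logb_prod _ _ fun i _ => h0 i]
  rwa [Real.lt_logb_iff_rpow_lt one_lt_two ((by positivity : (0 : ℝ) < 2 ^ c).trans h)]

section TypicalPairs

variable {X Z : Type*} [Fintype X] [Fintype Z] {P : X → ℝ} {W : X → Z → ℝ} {n : ℕ}

/-- A bound for the logarithms of the transition and letter probabilities. -/
def logBound (P : X → ℝ) (W : X → Z → ℝ) : ℝ :=
  1 + ∑ xz : X × Z, (|Real.logb 2 (P xz.1)| + |Real.logb 2 (W xz.1 xz.2)| +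
    |Real.logb 2 (outputDistr P W xz.2)|)

theorem logBound_pos : 0 < logBound P W := by
  have : 0 ≤ ∑ xz : X × Z, (|Real.logb 2 (P xz.1)| + |Real.logb 2 (W xz.1 xz.2)| +
    |Real.logb 2 (outputDistr P W xz.2)|) := Finset.sum_nonneg fun _ _ => by positivity
  unfold logBound
  linarith

theorem abs_log_le_logBound (xz : X × Z) :
    |Real.logb 2 (P xz.1)| + |Real.logb 2 (W xz.1 xz.2)| +
      |Real.logb 2 (outputDistr P W xz.2)| ≤ logBound P W := by
  have := Finset.single_le_sum (f := fun xz : X × Z => |Real.logb 2 (P xz.1)| +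
    |Real.logb 2 (W xz.1 xz.2)| + |Real.logb 2 (outputDistr P W xz.2)|)
    (fun _ _ => by positivity) (Finset.mem_univ xz)
  unfold logBound
  linarith

/-- The deviation is measured in units of the range `2 R`, so that the exponent no longer depends on
`R`. -/
theorem joint_tail_le (hn : 0 < n) (hW : ∀ x, W x ∈ stdSimplex ℝ Z) (hP : P ∈ stdSimplex ℝ X)
    {f : X × Z → ℝ} {R s : ℝ} (hR : 0 < R) (hf : ∀ xz, |f xz| ≤ R) (hs : 0 ≤ s) :
    ∑ c : Fin n → X × Z,
      (if n * (∑ xz : X × Z, P xz.1 * W xz.1 xz.2 * f xz + 2 * R * s) ≤ ∑ i, f (c i)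
        then ∏ i, P (c i).1 * W (c i).1 (c i).2 else 0) ≤ (2 : ℝ) ^ (-(n * s ^ 2)) := by
  have h := hoeffding_upper hn (fun _ => joint_mem_stdSimplex hW hP) (f := fun _ => f)
    (a := -R) (b := R) (by linarith) (fun _ xz => abs_le.1 (hf xz))
    (t := 2 * R * s) (by positivity)
  refine le_trans (le_of_eq ?_) (h.trans ?_)
  · refine Finset.sum_congr rfl fun c _ => ?_
    rw [Finset.sum_const, Finset.card_univ, Fintype.card_fin, nsmul_eq_mul, mul_add]
  · refine exp_neg_le_two_rpow_neg (by positivity) ?_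
    have : 2 * (n : ℝ) * (2 * R * s) ^ 2 / (R - -R) ^ 2 = 2 * n * s ^ 2 := by
      field_simp
      ring
    rw [this]
    have : 0 ≤ (n : ℝ) * s ^ 2 := by positivity
    linarith

/-- With high probability the input has probability at most `2 ^ (-n (H - κ))` and the likelihood
ratio of the output is at most `2 ^ (n (I + κ))`. -/
theorem typical_pairs (hn : 0 < n) (hW : ∀ x, W x ∈ stdSimplex ℝ Z) (hP : P ∈ stdSimplex ℝ X)
    {s : ℝ} (hs : 0 ≤ s) :
    1 - 2 * (2 : ℝ) ^ (-(n * s ^ 2)) ≤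
      ∑ x ∈ Finset.univ.filter (fun x : Fin n → X => ∏ i, P (x i) ≤
          (2 : ℝ) ^ (n * (-shannonEntropy P + 2 * logBound P W * s))),
        (∏ i, P (x i)) * ∑ z, truncated (channelPow W) (fun z => ∏ i, outputDistr P W (z i))
          ((2 : ℝ) ^ (n * (mutualInformation P W + 2 * logBound P W * s))) x z := by
  set R := logBound P W
  set A := (2 : ℝ) ^ (n * (mutualInformation P W + 2 * R * s)) with hA
  set D := (2 : ℝ) ^ (n * (-shannonEntropy P + 2 * R * s)) with hD
  set Qn : (Fin n → Z) → ℝ := fun z => ∏ i, outputDistr P W (z i) with hQn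
  have h1 := joint_tail_le hn hW hP (f := fun xz => Real.logb 2 (P xz.1)) logBound_pos
    (fun xz => (by
      have := abs_log_le_logBound (P := P) (W := W) xz
      have h1 := abs_nonneg (Real.logb 2 (W xz.1 xz.2))
      have h2 := abs_nonneg (Real.logb 2 (outputDistr P W xz.2))
      linarith : |Real.logb 2 (P xz.1)| ≤ logBound P W)) hs
  have h2 := joint_tail_le hn hW hP
    (f := fun xz => Real.logb 2 (W xz.1 xz.2) - Real.logb 2 (outputDistr P W xz.2)) logBound_pos
    (fun xz => (by
      have := abs_log_le_logBound (P := P) (W := W) xz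
      have h1 := abs_nonneg (Real.logb 2 (P xz.1))
      have h2 := abs_sub (Real.logb 2 (W xz.1 xz.2)) (Real.logb 2 (outputDistr P W xz.2))
      linarith : |Real.logb 2 (W xz.1 xz.2) - Real.logb 2 (outputDistr P W xz.2)| ≤
        logBound P W)) hs
  rw [sum_joint_fst hW fun x => Real.logb 2 (P x),
    show ∑ x, P x * Real.logb 2 (P x) = -shannonEntropy P by rw [shannonEntropy, neg_neg]] at h1
  change ∑ c : Fin n → X × Z, (if n * (mutualInformation P W + 2 * R * s) ≤ _ then _ else _) ≤ _
    at h2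
  have hone : ∑ c : Fin n → X × Z, ∏ i, P (c i).1 * W (c i).1 (c i).2 = 1 :=
    sum_prod_eq_one (p := fun _ (xz : X × Z) => P xz.1 * W xz.1 xz.2)
      fun _ => joint_mem_stdSimplex hW hP
  rw [Finset.sum_filter]
  have h3 : ∀ x : Fin n → X, (if ∏ i, P (x i) ≤ D then (∏ i, P (x i)) *
      ∑ z, truncated (channelPow W) Qn A x z else 0) = ∑ z, if ∏ i, P (x i) ≤ D then
        (∏ i, P (x i)) * truncated (channelPow W) Qn A x z else 0 := by
    intro x
    split_ifs
    · rw [Finset.mul_sum]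
    · simp
  rw [Finset.sum_congr rfl fun x _ => h3 x, sum_words_pair]
  -- Each pair of words of positive probability is retained by the truncation, or its input is too
  -- likely, or its likelihood ratio is too large. The last two events are the tails `h1` and `h2`.
  have h4 : ∀ c : Fin n → X × Z, ∏ i, P (c i).1 * W (c i).1 (c i).2 ≤
      (if ∏ i, P (c i).1 ≤ D then (∏ i, P (c i).1) *
        truncated (channelPow W) Qn A (fun i => (c i).1) (fun i => (c i).2) else 0) +
      (if n * (-shannonEntropy P + 2 * R * s) ≤ ∑ i, Real.logb 2 (P (c i).1)
        then ∏ i, P (c i).1 * W (c i).1 (c i).2 else 0) +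
      (if n * (mutualInformation P W + 2 * R * s) ≤
        ∑ i, (Real.logb 2 (W (c i).1 (c i).2) - Real.logb 2 (outputDistr P W (c i).2))
        then ∏ i, P (c i).1 * W (c i).1 (c i).2 else 0) := by
    intro c
    have hc0 : 0 ≤ ∏ i, P (c i).1 * W (c i).1 (c i).2 :=
      Finset.prod_nonneg fun i _ => mul_nonneg (hP.1 _) ((hW _).1 _)
    have hfst : 0 ≤ (if ∏ i, P (c i).1 ≤ D then (∏ i, P (c i).1) *
        truncated (channelPow W) Qn A (fun i => (c i).1) (fun i => (c i).2) else 0) := by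
      split_ifs
      · exact mul_nonneg (Finset.prod_nonneg fun i _ => hP.1 _)
          (truncated_nonneg (fun x => (channelPow_mem_stdSimplex hW x).1) _ _)
      · exact le_rfl
    have hsnd : ∀ p : Prop, 0 ≤ (if p then ∏ i, P (c i).1 * W (c i).1 (c i).2 else 0) := by
      intro p; split_ifs; exacts [hc0, le_rfl]
    by_cases hc : ∏ i, P (c i).1 * W (c i).1 (c i).2 = 0
    · rw [hc]
      simp only [ite_self, add_zero]
      exact hfst
    have hne : ∀ i, P (c i).1 * W (c i).1 (c i).2 ≠ 0 := fun i =>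
      (Finset.prod_ne_zero_iff.1 hc) i (Finset.mem_univ i)
    have hQne : ∀ i, outputDistr P W (c i).2 ≠ 0 := fun i h =>
      hne i (joint_eq_zero_of_outputDistr hW hP h)
    by_cases hPD : ∏ i, P (c i).1 ≤ D
    · by_cases hV : channelPow W (fun i => (c i).1) (fun i => (c i).2) ≤ A * Qn fun i => (c i).2
      · have : ∏ i, P (c i).1 * W (c i).1 (c i).2 = (if ∏ i, P (c i).1 ≤ D then
            (∏ i, P (c i).1) *
            truncated (channelPow W) Qn A (fun i => (c i).1) (fun i => (c i).2) else 0) := by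
          rw [if_pos hPD, truncated, if_pos hV, Finset.prod_mul_distrib]
          rfl
        linarith [hsnd (n * (-shannonEntropy P + 2 * R * s) ≤ ∑ i, Real.logb 2 (P (c i).1)),
          hsnd (n * (mutualInformation P W + 2 * R * s) ≤
            ∑ i, (Real.logb 2 (W (c i).1 (c i).2) - Real.logb 2 (outputDistr P W (c i).2)))]
      · rw [not_le] at hV
        have hQpos : 0 < Qn fun i => (c i).2 := Finset.prod_pos fun i _ =>
          lt_of_le_of_ne ((outputDistr_mem_stdSimplex hW hP).1 _) (hQne i).symm
        have h5 : A < ∏ i, W (c i).1 (c i).2 / outputDistr P W (c i).2 := by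
          rw [Finset.prod_div_distrib]
          exact (lt_div_iff₀ hQpos).2 hV
        have h6 := lt_logb_prod (p := fun xz : X × Z => W xz.1 xz.2 / outputDistr P W xz.2)
          (fun i => div_ne_zero (right_ne_zero_of_mul (hne i)) (hQne i)) h5
        rw [Finset.sum_congr rfl fun i _ =>
          Real.logb_div (right_ne_zero_of_mul (hne i)) (hQne i)] at h6
        rw [if_pos h6.le]
        linarith [hsnd (n * (-shannonEntropy P + 2 * R * s) ≤ ∑ i, Real.logb 2 (P (c i).1))]
    · have h6 := lt_logb_prod (p := fun xz : X × Z => P xz.1)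
        (fun i => left_ne_zero_of_mul (hne i)) (not_le.1 hPD)
      rw [if_pos (c := n * (-shannonEntropy P + 2 * R * s) ≤ _) h6.le]
      linarith [hsnd (n * (mutualInformation P W + 2 * R * s) ≤
            ∑ i, (Real.logb 2 (W (c i).1 (c i).2) - Real.logb 2 (outputDistr P W (c i).2)))]
  have h5 := Finset.sum_le_sum fun c (_ : c ∈ Finset.univ) => h4 c
  rw [hone, Finset.sum_add_distrib, Finset.sum_add_distrib] at h5
  linarith

end TypicalPairs

/-! ### Construction of the codes -/

section Codes

variable {X Z : Type*} {n : ℕ} {σ : ℝ}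

/-- The pairs `(a, μ)` are enumerated injectively by `a * L + μ`, block after block. -/
theorem codeSpread_of_seq {K L : ℕ} {w : ℕ → Fin n → X}
    (h : ∀ k < K * L, ∀ j < k, ¬ (hammingDist (w j) (w k) : ℝ) < 2 * σ * n) :
    CodeSpread σ fun (a : Fin K) (μ : Fin L) => w (a * L + μ) := by
  intro a μ a' μ' hne
  have hlt : ∀ (a : Fin K) (μ : Fin L), (a * L + μ : ℕ) < K * L := by
    intro a μ
    have : ((a : ℕ) + 1) * L ≤ K * L := Nat.mul_le_mul_right L a.2
    rw [add_mul, one_mul] at this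
    omega
  rcases lt_trichotomy (a * L + μ : ℕ) (a' * L + μ') with h1 | h1 | h1
  · exact not_lt.1 (h _ (hlt a' μ') _ h1)
  · exfalso
    apply hne
    have h2 : (μ : ℕ) = μ' := by
      have := congrArg (· % L) h1
      simpa [Nat.mul_add_mod', Nat.mod_eq_of_lt] using this
    have hL : 0 < L := μ.pos
    have h3 : (a : ℕ) = a' := by
      rw [h2] at h1
      exact Nat.eq_of_mul_eq_mul_right hL (Nat.add_right_cancel h1)
    exact Prod.ext (Fin.ext h3) (Fin.ext h2)
  · have := not_lt.1 (h _ (hlt a μ) _ h1)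
    rwa [hammingDist_comm] at this

/-- The Gilbert–Varshamov bound. -/
theorem exists_spread_seq [Fintype X] [Nonempty X] {K : ℕ} {v d : ℝ}
    (hball : ∀ u : Fin n → X,
      ((Finset.univ.filter fun w : Fin n → X => (hammingDist u w : ℝ) < d).card : ℝ) ≤ v)
    (hv : 0 < v) (hK : K * v ≤ (Fintype.card X : ℝ) ^ n) :
    ∃ w : ℕ → Fin n → X, ∀ k < K, ∀ j < k, ¬ (hammingDist (w j) (w k) : ℝ) < d := by
  refine exists_seq_of_step (R := fun k w x => ∀ j < k, ¬ (hammingDist (w j) x : ℝ) < d)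
    (fun k w w' x h h1 j hj => by rw [← h j hj]; exact h1 j hj) K fun k hk w => ?_
  by_contra! hc
  have h1 : (Finset.univ : Finset (Fin n → X)) ⊆ (Finset.range k).biUnion fun j =>
      Finset.univ.filter fun x : Fin n → X => (hammingDist (w j) x : ℝ) < d := by
    intro x _
    obtain ⟨j, hj, hjx⟩ := hc x
    exact Finset.mem_biUnion.2 ⟨j, Finset.mem_range.2 hj,
      Finset.mem_filter.2 ⟨Finset.mem_univ x, hjx⟩⟩
  have h2 := (Finset.card_le_card h1).trans Finset.card_biUnion_le
  rw [Finset.card_univ, Fintype.card_fun, Fintype.card_fin] at h2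
  have h3 : (Fintype.card X : ℝ) ^ n ≤ ∑ j ∈ Finset.range k,
      ((Finset.univ.filter fun x : Fin n → X => (hammingDist (w j) x : ℝ) < d).card : ℝ) := by
    exact_mod_cast h2
  have h4 := h3.trans (Finset.sum_le_sum fun j _ => hball (w j))
  rw [Finset.sum_const, Finset.card_range, nsmul_eq_mul] at h4
  have h5 : (k : ℝ) < K := by exact_mod_cast hk
  nlinarith

variable [Fintype X] [Fintype Z] {P : X → ℝ} {W : X → Z → ℝ}

/-- A total variation distance never exceeds one. -/
theorem codeBlurred_of_one_le (hW : ∀ x, W x ∈ stdSimplex ℝ Z) (hP : P ∈ stdSimplex ℝ X)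
    {K L : ℕ} (hL : 0 < L) (ξ : Fin K → Fin L → Fin n → X) {θ : ℝ} (hθ : 1 ≤ θ) :
    CodeBlurred W P θ ξ := by
  intro a
  have hLr : (0 : ℝ) < L := by exact_mod_cast hL
  have hQ := prod_mem_stdSimplex fun _ : Fin n => outputDistr_mem_stdSimplex hW hP
  have h0 : ∀ z : Fin n → Z, 0 ≤ 1 / (L : ℝ) * ∑ μ, channelPow W (ξ a μ) z := fun z =>
    mul_nonneg (by positivity)
      (Finset.sum_nonneg fun μ _ => (channelPow_mem_stdSimplex hW _).1 z)
  have h1 : ∑ z : Fin n → Z, 1 / (L : ℝ) * ∑ μ, channelPow W (ξ a μ) z = 1 := by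
    rw [← Finset.mul_sum, Finset.sum_comm,
      Finset.sum_congr rfl fun μ _ => (channelPow_mem_stdSimplex hW (ξ a μ)).2]
    simp [hLr.ne']
  have h2 : ∑ z : Fin n → Z,
      |1 / (L : ℝ) * ∑ μ, channelPow W (ξ a μ) z - ∏ i, outputDistr P W (z i)| ≤ 2 := by
    calc _ ≤ ∑ z : Fin n → Z,
          (1 / (L : ℝ) * ∑ μ, channelPow W (ξ a μ) z + ∏ i, outputDistr P W (z i)) := by
          refine Finset.sum_le_sum fun z _ => ?_
          have h3 := h0 z
          have h4 : 0 ≤ ∏ i, outputDistr P W (z i) := hQ.1 z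
          rw [abs_le]
          constructor <;> linarith
      _ = 2 := by
          rw [Finset.sum_add_distrib, h1, hQ.2]
          norm_num
  linarith

/-- Codes with spread and blurred blocks exist as soon as `K L` is below the packing bound. -/
theorem exists_blurred_code [Nonempty X] (hn : 0 < n) (hW : ∀ x, W x ∈ stdSimplex ℝ Z)
    (hP : P ∈ stdSimplex ℝ X) {s v q A : ℝ} (hs : 0 ≤ s) (hv : 0 ≤ v)
    (hball : ∀ u : Fin n → X, ((Finset.univ.filter fun w : Fin n → X =>
      (hammingDist u w : ℝ) < 2 * σ * n).card : ℝ) ≤ v)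
    (hq : 0 < q) (hqs : q ^ 2 = (2 : ℝ) ^ (-(n * s ^ 2))) (hq1 : q ≤ 1 / 25)
    (hA : A = (2 : ℝ) ^ (n * (mutualInformation P W + 2 * logBound P W * s)))
    {K L : ℕ} (hL : 0 < L) (hLA : (A + 1) / q ^ 2 ≤ L)
    (hKL : K * L * (v * (2 : ℝ) ^ (n * (-shannonEntropy P + 2 * logBound P W * s))) ≤ q ^ 2) :
    ∃ ξ : Fin K → Fin L → Fin n → X, CodeSpread σ ξ ∧ CodeBlurred W P (25 * q) ξ := by
  have hLr : (0 : ℝ) < L := by exact_mod_cast hL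
  have hA0 : 0 < A := by rw [hA]; positivity
  set D := (2 : ℝ) ^ (n * (-shannonEntropy P + 2 * logBound P W * s)) with hD
  have hD0 : 0 < D := by positivity
  -- A ball contains at most `v` words of `T`, each of probability at most `D`, so `ν = v D`. The
  -- loss `γ` is `2 q²` from the two tails and `q²` from all the balls; the distance obtained in the
  -- end is at most `7 q`.
  obtain ⟨w, hw1, hw2⟩ := exists_covering_blocks (K := K) (L := L)
    (π := fun x : Fin n → X => ∏ i, P (x i)) (V := channelPow W)
    (Q := fun z => ∏ i, outputDistr P W (z i)) (A := A) (γ := 3 * q ^ 2) (γ₀ := 2 * q ^ 2)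
    (T := Finset.univ.filter fun x : Fin n → X => ∏ i, P (x i) ≤ D)
    (near := fun u w => (hammingDist u w : ℝ) < 2 * σ * n) (ν := v * D)
    (prod_mem_stdSimplex fun _ => hP) (channelPow_mem_stdSimplex hW)
    (fun z => (sum_word_mul_channelPow P W z).symm) hA0.le hL
    (by rw [hqs, hA]; exact typical_pairs hn hW hP hs)
    (fun u => by
      calc _ ≤ ∑ _x ∈ (Finset.univ.filter fun x : Fin n → X => ∏ i, P (x i) ≤ D).filter
            (fun w => (hammingDist u w : ℝ) < 2 * σ * n), D :=
            Finset.sum_le_sum fun x hx =>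
              (Finset.mem_filter.1 (Finset.mem_filter.1 hx).1).2
        _ ≤ v * D := by
            rw [Finset.sum_const, nsmul_eq_mul]
            refine mul_le_mul_of_nonneg_right (le_trans ?_ (hball u)) hD0.le
            exact_mod_cast Finset.card_le_card
              (Finset.filter_subset_filter _ (Finset.subset_univ _)))
    (by positivity) (by push_cast; linarith) (by nlinarith)
  refine ⟨fun a μ => w (a * L + μ), codeSpread_of_seq hw1, fun a => ?_⟩
  have h1 := hw2 a a.2
  have h2 : Real.sqrt ((A + 1) / L) ≤ q := by
    rw [Real.sqrt_le_left hq.le, div_le_iff₀ hLr]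
    rwa [div_le_iff₀ (by positivity), mul_comm] at hLA
  have h3 : Real.sqrt (2 * (3 * q ^ 2)) ≤ 3 * q := by
    rw [Real.sqrt_le_left (by positivity)]
    nlinarith [sq_nonneg q]
  linarith

end Codes

theorem shannonEntropy_pair_nonneg {p : ℝ} (hp0 : 0 ≤ p) (hp1 : p ≤ 1) :
    0 ≤ shannonEntropy ![p, 1 - p] := by
  have h1 : p * Real.logb 2 p ≤ 0 :=
    mul_nonpos_of_nonneg_of_nonpos hp0 (Real.logb_nonpos one_lt_two hp0 hp1)
  have h2 : (1 - p) * Real.logb 2 (1 - p) ≤ 0 :=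
    mul_nonpos_of_nonneg_of_nonpos (by linarith)
      (Real.logb_nonpos one_lt_two (by linarith) (by linarith))
  simp [shannonEntropy]
  linarith

/-- Codes of large rate: either there is a single codeword, or all blocks are blurred. -/
theorem exists_code_of_rate {X Z : Type*} [Fintype X] [Fintype Z] [Nonempty X] [Nonempty Z]
    {P : X → ℝ} {W : X → Z → ℝ} (hW : ∀ x, W x ∈ stdSimplex ℝ Z) (hP : P ∈ stdSimplex ℝ X)
    {n : ℕ} (hn : 0 < n) {σ s t : ℝ} (hσ : 0 < σ) (hσ' : σ ≤ 1 / 2) (hs : 0 ≤ s)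
    (hs1 : Nontrivial X → s ≤ 1)
    (ht : t + s * (4 * logBound P W + 2) * n + n * (shannonEntropy ![2 * σ, 1 - 2 * σ] +
      2 * σ * Real.logb 2 (Fintype.card X)) + 3 ≤ n * equivocation P W) :
    ∃ (K L : ℕ) (_ : 0 < K) (_ : 0 < L) (ξ : Fin K → Fin L → Fin n → X),
      CodeSpread σ ξ ∧
      (K = 1 ∨ CodeBlurred W P (25 * (Fintype.card X : ℝ) * (Fintype.card Z : ℝ) *
        (2 : ℝ) ^ (-(n * (s ^ 2 / 2)))) ξ) ∧ t ≤ Real.logb 2 K := by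
  have hnr : (0 : ℝ) < n := by exact_mod_cast hn
  have hX : (1 : ℝ) ≤ Fintype.card X := by exact_mod_cast Fintype.card_pos
  have hZ : (1 : ℝ) ≤ Fintype.card Z := by exact_mod_cast Fintype.card_pos
  have hXZ : 1 ≤ (Fintype.card X : ℝ) * Fintype.card Z := one_le_mul_of_one_le_of_one_le hX hZ
  have hR : 0 < logBound P W := logBound_pos
  set E := n * (shannonEntropy ![2 * σ, 1 - 2 * σ] + 2 * σ * Real.logb 2 (Fintype.card X)) with hE
  have hlogX : 0 ≤ Real.logb 2 (Fintype.card X) := Real.logb_nonneg one_lt_two hX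
  have hE0 : 0 ≤ E := by
    have := shannonEntropy_pair_nonneg (p := 2 * σ) (by linarith) (by linarith)
    positivity
  have hG0 : 0 ≤ s * (4 * logBound P W + 2) * n := by positivity
  have heq := equivocation_le hW hP
  rcases le_or_gt t 0 with ht0 | ht0
  · refine ⟨1, 1, one_pos, one_pos, fun _ _ _ => Classical.arbitrary X, ?_, Or.inl rfl,
      by simpa using ht0⟩
    intro a μ a' μ' hne
    exact absurd (Subsingleton.elim _ _) hne
  -- On a one-letter alphabet the equivocation is at most zero, which contradicts `t > 0`.
  have hntX : Nontrivial X := by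
    by_contra h
    rw [not_nontrivial_iff_subsingleton] at h
    have h1 : Fintype.card X = 1 :=
      le_antisymm (Fintype.card_le_one_iff_subsingleton.2 h) Fintype.card_pos
    rw [h1, Nat.cast_one, Real.logb_one] at heq
    nlinarith
  have hs1 := hs1 hntX
  set K := ⌈(2 : ℝ) ^ t⌉₊ with hK
  have h2t : 1 ≤ (2 : ℝ) ^ t := Real.one_le_rpow one_le_two ht0.le
  have hKt : (2 : ℝ) ^ t ≤ K := Nat.le_ceil _
  have hKt' : (K : ℝ) ≤ (2 : ℝ) ^ (t + 1) := by
    rw [Real.rpow_add two_pos, Real.rpow_one]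
    have := Nat.ceil_lt_add_one (by positivity : 0 ≤ (2 : ℝ) ^ t)
    linarith
  have hK0 : 0 < K := Nat.ceil_pos.2 (by positivity)
  have hrate : t ≤ Real.logb 2 K := by
    rw [Real.le_logb_iff_rpow_le one_lt_two (by exact_mod_cast hK0)]
    exact hKt
  have hball := fun u : Fin n → X => card_hammingBall_le u (p := 2 * σ) (by linarith) (by linarith)
  set q := (2 : ℝ) ^ (-(n * (s ^ 2 / 2))) with hq
  have hq0 : 0 < q := by positivity
  -- If the allowed distance is at least one, blurring is free and a packing with `L = 1` suffices.
  -- Otherwise `q ≤ 1 / 25` and the covering argument applies.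
  rcases le_or_gt (1 / 25) (Fintype.card X * Fintype.card Z * q) with hc | hc
  · obtain ⟨w, hw⟩ := exists_spread_seq (K := K * 1) hball (by positivity) (by
      rw [mul_one]
      calc (K : ℝ) * 2 ^ E ≤ 2 ^ (t + 1) * 2 ^ E := by gcongr
        _ = 2 ^ (t + 1 + E) := (Real.rpow_add two_pos _ _).symm
        _ ≤ 2 ^ (Real.logb 2 (Fintype.card X) * n) := by
            refine Real.rpow_le_rpow_of_exponent_le one_le_two ?_
            nlinarith
        _ = (Fintype.card X : ℝ) ^ n := by
            rw [Real.rpow_mul two_pos.le, Real.rpow_logb two_pos (by norm_num) (by linarith),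
              Real.rpow_natCast])
    refine ⟨K, 1, hK0, one_pos, _, codeSpread_of_seq hw, Or.inr ?_, hrate⟩
    exact codeBlurred_of_one_le hW hP one_pos _ (by linarith)
  · have hq1 : q ≤ 1 / 25 := by nlinarith
    have hqs : q ^ 2 = (2 : ℝ) ^ (-(n * s ^ 2)) := by
      rw [hq, ← Real.rpow_natCast, ← Real.rpow_mul two_pos.le]
      congr 1
      push_cast
      ring
    set A := (2 : ℝ) ^ (n * (mutualInformation P W + 2 * logBound P W * s)) with hA
    have hA1 : 1 ≤ A := by
      have := mutualInformation_nonneg hW hP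
      exact Real.one_le_rpow one_le_two (by positivity)
    set L := ⌈(A + 1) / q ^ 2⌉₊ with hLdef
    have hL0 : 0 < L := Nat.ceil_pos.2 (by positivity)
    -- Rounding up costs two bits: `A + 1 + q² ≤ 4 A`, because `A ≥ 1` and `q ≤ 1`.
    have hLle : (L : ℝ) ≤ 2 ^ (2 + n * (mutualInformation P W + 2 * logBound P W * s) + n * s ^ 2)
        := by
      have h1 := Nat.ceil_lt_add_one (by positivity : 0 ≤ (A + 1) / q ^ 2)
      have h2 : (2 : ℝ) ^ (2 + n * (mutualInformation P W + 2 * logBound P W * s) + n * s ^ 2) =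
          4 * A / q ^ 2 := by
        rw [Real.rpow_add two_pos, Real.rpow_add two_pos, hqs, Real.rpow_neg two_pos.le,
          div_inv_eq_mul, hA]
        norm_num
      rw [h2]
      refine h1.le.trans ?_
      rw [div_add_one (by positivity)]
      gcongr
      nlinarith
    obtain ⟨ξ, h1, h2⟩ := exists_blurred_code (σ := σ) (K := K) (L := L) hn hW hP hs
      (by positivity) hball hq0 hqs hq1 hA hL0 (Nat.le_ceil _) (by
        calc (K : ℝ) * L * (2 ^ E * 2 ^ (n * (-shannonEntropy P + 2 * logBound P W * s))) ≤
            2 ^ (t + 1) *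
            2 ^ (2 + n * (mutualInformation P W + 2 * logBound P W * s) + n * s ^ 2) *
            (2 ^ E * 2 ^ (n * (-shannonEntropy P + 2 * logBound P W * s))) := by gcongr
          _ = 2 ^ (t + 1 + (2 + n * (mutualInformation P W + 2 * logBound P W * s) + n * s ^ 2) +
              (E + n * (-shannonEntropy P + 2 * logBound P W * s))) := by
              rw [← Real.rpow_add two_pos, ← Real.rpow_add two_pos, ← Real.rpow_add two_pos]
          -- The constant `3` in `ht` is one bit for rounding `K` and two for `L`. The slope `4 *
          -- logBound P W + 2` collects two fluctuations `2 * logBound P W * s` and two terms `s² ≤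
          -- s`, one from `L` and one from the target `q²`.
          _ ≤ q ^ 2 := by
              rw [hqs]
              refine Real.rpow_le_rpow_of_exponent_le one_le_two ?_
              rw [equivocation_eq hW] at ht
              have : n * s ^ 2 ≤ s * n := by nlinarith
              linarith)
    refine ⟨K, L, hK0, hL0, ξ, h1, Or.inr fun a => (h2 a).trans ?_, hrate⟩
    nlinarith

end Commitment

end

/-! ### Assembly of the theorem -/

open Commitment
theorem proposition3 {X Z : Type*} [Fintype X] [Fintype Z] :
    ∃ C : ℝ, ∀ (W : X → Z → ℝ) (P : X → ℝ),
      (∀ x, W x ∈ stdSimplex ℝ Z) → P ∈ stdSimplex ℝ X →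
      ∃ G' : ℝ, ∀ (σ η τ ε δ : ℝ) (n : ℕ),
        0 < σ → σ ≤ 1 / 2 → 0 < η → 1 ≤ n → Separated W η →
        τ = σ ^ 4 * η ^ 2 / (8 * (Fintype.card X : ℝ) ^ 4 * (Fintype.card Z : ℝ) ^ 2) →
        ε = 50 * (Fintype.card X : ℝ) * (Fintype.card Z : ℝ) * (2 : ℝ) ^ (-((n : ℝ) * τ)) →
        δ = 2 * (Fintype.card X : ℝ) * (Fintype.card Z : ℝ) *
          (2 : ℝ) ^ (-(2 * (n : ℝ) * τ ^ 2)) →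
        (∀ (K L : ℕ) (hL : 0 < L) (ξ : Fin K → Fin L → Fin n → X),
          CodeSpread σ ξ → CodeBlurred W P (ε / 2) ξ →
          (oneShot W (Real.sqrt (2 * τ)) hL ξ).IsConcealing W ε ∧
          (oneShot W (Real.sqrt (2 * τ)) hL ξ).IsBinding W δ) ∧
        ∃ (K L : ℕ) (_ : 0 < K) (hL : 0 < L) (ξ : Fin K → Fin L → Fin n → X),
          CodeSpread σ ξ ∧ (2 ≤ K → CodeBlurred W P (ε / 2) ξ) ∧
          (oneShot W (Real.sqrt (2 * τ)) hL ξ).IsConcealing W ε ∧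
          (oneShot W (Real.sqrt (2 * τ)) hL ξ).IsBinding W δ ∧
          equivocation P W - Real.sqrt (2 * τ) * G' - shannonEntropy ![2 * σ, 1 - 2 * σ]
              - 2 * σ * Real.logb 2 (Fintype.card X) - Real.logb 2 n / n - C / n
            ≤ (oneShot W (Real.sqrt (2 * τ)) hL ξ).rate := by
  refine ⟨3, fun W P hW hP => ⟨4 * logBound P W + 2, ?_⟩⟩
  intro σ η τ ε δ n hσ hσ' hη hn hsep hτ hε hδ
  have hX : Nonempty X := by
    by_contra h
    rw [not_nonempty_iff] at h
    simpa using hP.2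
  have hZ : Nonempty Z := by
    by_contra h
    rw [not_nonempty_iff] at h
    simpa using (hW (Classical.arbitrary X)).2
  have hnr : (0 : ℝ) < n := by exact_mod_cast hn
  have hτ0 : 0 ≤ τ := by rw [hτ]; positivity
  have hsq : Real.sqrt (2 * τ) ^ 2 = 2 * τ := Real.sq_sqrt (by positivity)
  subst hδ
  refine ⟨fun K L hL ξ h1 h2 => ⟨oneShot_isConcealing hL h2,
    oneShot_isBinding hn hW hσ hσ' hη hsep hτ hL h1⟩, ?_⟩
  -- With `s = √(2τ)` one has `s² / 2 = τ`, so the blurring bound obtained is exactly `ε / 2`; `t`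
  -- is the largest value that the hypothesis on the rate permits.
  obtain ⟨K, L, hK, hL, ξ, h1, h2, h3⟩ := exists_code_of_rate hW hP (n := n) hn hσ hσ'
    (Real.sqrt_nonneg (2 * τ))
    (fun _ => (sqrt_two_mul_le hσ hσ' hη (le_two_of_separated hW hsep) hτ).1)
    (t := n * (equivocation P W - Real.sqrt (2 * τ) * (4 * logBound P W + 2) -
      shannonEntropy ![2 * σ, 1 - 2 * σ] - 2 * σ * Real.logb 2 (Fintype.card X)) - 3)
    (le_of_eq (by ring))
  have h2' : 2 ≤ K → CodeBlurred W P (ε / 2) ξ := by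
    intro hK2
    rcases h2 with h2 | h2
    · omega
    · convert h2 using 1
      rw [hε, hsq, mul_div_cancel_left₀ _ two_ne_zero]
      ring
  refine ⟨K, L, hK, hL, ξ, h1, h2', ?_, oneShot_isBinding hn hW hσ hσ' hη hsep hτ hL h1, ?_⟩
  -- With a single message there is nothing to conceal, so no blurring is needed.
  · rcases h2 with rfl | h2
    · intro a a' T _ pT _ B
      rw [Subsingleton.elim a a']
      simp only [sub_self, abs_zero, Finset.sum_const_zero, mul_zero]
      rw [hε]
      positivity
    · exact oneShot_isConcealing hL (by
        convert h2 using 1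
        rw [hε, hsq, mul_div_cancel_left₀ _ two_ne_zero]
        ring)
  · rw [Protocol.rate, Fintype.card_fin, le_div_iff₀ hnr]
    refine le_trans ?_ h3
    -- The construction loses no logarithmic term; the claimed bound is weaker by `log n / n ≥ 0`.
    have hlog : 0 ≤ Real.logb 2 (n : ℝ) := Real.logb_nonneg one_lt_two (by exact_mod_cast hn)
    have h4 : Real.logb 2 n / n * n = Real.logb 2 n := div_mul_cancel₀ _ hnr.ne'
    have h5 : (3 : ℝ) / n * n = 3 := div_mul_cancel₀ _ hnr.ne'
    linarith
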